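/- Let $n\ge 3$, $t\neq 0$ and $x$ be rational integers, and let $\sqrt t$ be the principal square root. Let $\beta_1=a+b\sqrt t$ be an algebraic integer with $a,b\in\mathbb{Q}$, $b\neq 0$, and $\beta_2=a-b\sqrt t$. Let $\gamma_1=v+w\sqrt t$ ($v,w\in\mathbb{Q}$) be an algebraic integer in $\mathbb{Q}(\sqrt t)$, with conjugate $\gamma_2=v-w\sqrt t$. ($t$ may be a perfect square; then "conjugate" means changing the sign of $\sqrt t$ in the given representation, and $\beta_2$ is also assumed to be an integer.) Put $$U(x)=-\gamma_2(x-\beta_2)^n,\quad Z(x)=\gamma_1(x-\beta_1)^n,\quad W(x)=\frac{Z(x)}{U(x)},\quad \mathcal A(x)=\frac{\beta_1(x-\beta_2)W(x)^{1/n}-\beta_2(x-\beta_1)}{(x-\beta_2)W(x)^{1/n}-(x-\beta_1)},$$ where $(se^{i\varphi})^{1/n}=s^{1/n}e^{i\varphi/n}$ for $s\ge 0$, $-\pi<\varphi\le\pi$; the denominator of $\mathcal A(x)$ is assumed to be non-zero. Let $u_1,u_2\in\mathbb{Z}$ be such that $U(x)=(u_1+u_2\sqrt t)/2$ (and $Z(x)=(-u_1+u_2\sqrt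 t)/2$, which follows automatically unless $t$ is a perfect square), and let $u_1\ne0$. For a positive integer $N$ let $\mathrm{core}(N)$ be the squarefree divisor $N_1$ of $N$ such that $N/N_1$ is a perfect square. Put $$g_1=\gcd(u_1,u_2),\qquad g_2=\gcd(u_1/g_1,t),$$ $$g_3=\begin{cases}1&\text{if } t\equiv1 \bmod 4 \text{ and } (u_1-u_2)/g_1\equiv0\bmod 2,\\ 2&\text{if } t\equiv3 \bmod 4\text{ and } (u_1-u_2)/g_1\equiv0\bmod 2,\\ 4&\text{otherwise},\end{cases}$$ $$g_4=\gcd\left(\mathrm{core}(g_2g_3),\ \frac{\gcd(2,n)\,n}{\gcd(u_1/g_1,\gcd(2,n)\,n)}\right),\qquad g=\frac{g_1\sqrt{g_2}}{\sqrt{g_3g_4}},$$ and let $d$ be the largest positive integer such that $u_1/(dg)$ is an algebraic integer. For $r\ge0$ let $X_{n,r}(y)={}_2F_1(-r,-r-1/n;1-1/n;y)$, let $D_{n,r}$ be the smallest positive integer such that $D_{n,r}X_{n,r}(y)$ has integer coefficients, let $N_{d,n,r}$ be the greatest common divisor of the numerators of the coefficients of $X_{n,r}(1-dy)$, and put $\mathcal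 N_{d,n}=\prod_{p\mid n}p^{\min(v_p(d),\,v_p(n)+1/(p-1))}$. Let $\mathcal C_n,\mathcal D_n$ be any positive real numbers such that $$\max\left(1,\frac{\Gamma(1-1/n)\,r!}{\Gamma(r+1-1/n)},\frac{n\,\Gamma(r+1+1/n)}{\Gamma(1/n)\,r!}\right)\frac{D_{n,r}}{N_{d,n,r}}<\mathcal C_n\left(\frac{\mathcal D_n}{\mathcal N_{d,n}}\right)^r\qquad\text{for all } r\ge 0.$$ Put $$E=\frac{|g|\,\mathcal N_{d,n}}{\mathcal D_n\min_{\pm}\left|u_2\sqrt t\pm\sqrt{u_2^2t-u_1^2}\right|},\qquad Q=\frac{\mathcal D_n\max_{\pm}\left|u_2\sqrt t\pm\sqrt{u_2^2t-u_1^2}\right|}{|g|\,\mathcal N_{d,n}},\qquad \kappa=\frac{\log Q}{\log E},$$ $$c=4\sqrt{|2t|}\,\bigl(|x-\beta_1|+|x-\beta_2|\bigr)\,\mathcal C_n\,Q\,\Bigl(\max\bigl(1,\ 5\sqrt{|2t|}\,|1-W(x)^{1/n}|\,|x-\beta_2|\,|\mathcal A(x)-\beta_1|\,\mathcal C_n E\bigr)\Bigr)^{\kappa}.$$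 If $E>1$ and either $0<W(x)<1$ or $|W(x)|=1$ with $W(x)\ne-1$, then $$\left|\mathcal A(x)-\frac pq\right|>\frac1{c\,|q|^{\kappa+1}}$$ for all rational integers $p$ and $q$ with $q\neq0$. -/

import Mathlib

namespace ThueFT

/-- The hypergeometric polynomial `X_{n,r}(x) = ₂F₁(-r, -r - 1/n; 1 - 1/n; x)`, as a polynomial
with rational coefficients (the series terminates at degree `r`). -/
noncomputable def hypPoly (n r : ℕ) : Polynomial ℚ :=
  ∑ k ∈ Finset.range (r + 1),
    Polynomial.monomial k
      (ordinaryHypergeometricCoefficient (-(r : ℚ)) (-(r : ℚ) - 1 / n) (1 - 1 / n) k)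

/-- `D_{n,r}`: the smallest positive integer `D` such that `D * X_{n,r}(x)` has integer
coefficients. -/
noncomputable def denom (n r : ℕ) : ℕ :=
  sInf {D : ℕ | 0 < D ∧ ∀ k : ℕ, ∃ z : ℤ, (D : ℚ) * (hypPoly n r).coeff k = z}

/-- `N_{d,n,r}`: the greatest common divisor of the numerators of the coefficients of
`X_{n,r}(1 - d x)`. -/
noncomputable def numGcd (d n r : ℕ) : ℕ :=
  (Finset.range (r + 1)).gcd fun k =>
    (((hypPoly n r).comp (1 - Polynomial.C (d : ℚ) * Polynomial.X)).coeff k).num.natAbs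

/-- `𝒩_{d,n} = ∏_{p ∣ n} p ^ min (v_p(d), v_p(n) + 1 / (p - 1))`. -/
noncomputable def calN (d n : ℕ) : ℝ :=
  ∏ p ∈ n.primeFactors,
    (p : ℝ) ^ min (padicValNat p d : ℝ) ((padicValNat p n : ℝ) + 1 / ((p : ℝ) - 1))

/-- The condition that the positive reals `C`, `D` are admissible values of `𝒞_n`, `𝒟_n`. -/
def Admissible (d n : ℕ) (C D : ℝ) : Prop :=
  0 < C ∧ 0 < D ∧ ∀ r : ℕ,
    max 1 (max (Real.Gamma (1 - 1 / n) * (r.factorial : ℝ) / Real.Gamma (r + 1 - 1 / n))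
        (n * Real.Gamma (r + 1 + 1 / n) / (Real.Gamma (1 / n) * (r.factorial : ℝ))))
      * ((denom n r : ℝ) / (numGcd d n r : ℝ)) < C * (D / calN d n) ^ r

/-- `core(N)` for a positive integer `N`: the squarefree divisor of `N` with square cofactor,
i.e. the product of the primes that occur in `N` to an odd power. -/
def sqfCore (N : ℕ) : ℕ :=
  ∏ p ∈ N.primeFactors with Odd (N.factorization p), p

theorem sqfCore_spec {N : ℕ} (hN : N ≠ 0) :
    Squarefree (sqfCore N) ∧ ∃ k : ℕ, N = sqfCore N * k ^ 2 := by
  constructor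
  · unfold sqfCore
    refine Finset.squarefree_prod_of_pairwise_isCoprime ?_ ?_
    · intro p hp q hq hpq
      have h1 := Nat.prime_of_mem_primeFactors (Finset.mem_filter.1 hp).1
      have h2 := Nat.prime_of_mem_primeFactors (Finset.mem_filter.1 hq).1
      exact Nat.coprime_iff_isRelPrime.1 ((Nat.coprime_primes h1 h2).2 hpq)
    · intro p hp
      exact (Nat.prime_of_mem_primeFactors (Finset.mem_filter.1 hp).1).prime.squarefree
  · refine ⟨∏ p ∈ N.primeFactors, p ^ (N.factorization p / 2), ?_⟩
    conv_lhs => rw [← Nat.prod_factorization_pow_eq_self hN]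
    rw [Finsupp.prod, Nat.support_factorization, sqfCore, Finset.prod_filter, ← Finset.prod_pow,
      ← Finset.prod_mul_distrib]
    refine Finset.prod_congr rfl fun p _ => ?_
    split_ifs with h
    · obtain ⟨m, hm⟩ := h
      rw [hm, show (2 * m + 1) / 2 = m by omega]; ring
    · obtain ⟨m, hm⟩ := Nat.not_odd_iff_even.1 h
      rw [hm, show (m + m) / 2 = m by omega]; ring

def g₁ (u₁ u₂ : ℤ) : ℕ := Int.gcd u₁ u₂

def g₂ (u₁ u₂ t : ℤ) : ℕ := Int.gcd (u₁ / g₁ u₁ u₂) t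

def g₃ (u₁ u₂ t : ℤ) : ℕ :=
  if t ≡ 1 [ZMOD 4] ∧ (u₁ - u₂) / g₁ u₁ u₂ ≡ 0 [ZMOD 2] then 1
  else if t ≡ 3 [ZMOD 4] ∧ (u₁ - u₂) / g₁ u₁ u₂ ≡ 0 [ZMOD 2] then 2
  else 4

def g₄ (n : ℕ) (u₁ u₂ t : ℤ) : ℕ :=
  Nat.gcd (sqfCore (g₂ u₁ u₂ t * g₃ u₁ u₂ t))
    ((Nat.gcd 2 n * n) / Int.gcd (u₁ / g₁ u₁ u₂) ((Nat.gcd 2 n * n : ℕ) : ℤ))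

/-- `g = g₁ √g₂ / √(g₃ g₄)`. -/
noncomputable def gTot (n : ℕ) (u₁ u₂ t : ℤ) : ℝ :=
  (g₁ u₁ u₂ : ℝ) * √(g₂ u₁ u₂ t : ℝ) / √((g₃ u₁ u₂ t : ℝ) * (g₄ n u₁ u₂ t : ℝ))

/-- The principal `n`-th root `s e^{iφ} ↦ s^{1/n} e^{iφ/n}`, `-π < φ ≤ π`. -/
noncomputable def nthRoot (n : ℕ) (w : ℂ) : ℂ := w ^ (1 / (n : ℂ))

/-- `U(x) = -γ₂ (x - β₂)ⁿ`. -/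
noncomputable def U (n : ℕ) (β₂ γ₂ x : ℂ) : ℂ := -γ₂ * (x - β₂) ^ n

/-- `Z(x) = γ₁ (x - β₁)ⁿ`. -/
noncomputable def Z (n : ℕ) (β₁ γ₁ x : ℂ) : ℂ := γ₁ * (x - β₁) ^ n

/-- `W(x) = Z(x) / U(x)`. -/
noncomputable def W (n : ℕ) (β₁ β₂ γ₁ γ₂ x : ℂ) : ℂ := Z n β₁ γ₁ x / U n β₂ γ₂ x

/-- The denominator `(x - β₂) W(x)^{1/n} - (x - β₁)` of `𝒜(x)`. -/
noncomputable def calADen (n : ℕ) (β₁ β₂ γ₁ γ₂ x : ℂ) : ℂ :=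
  (x - β₂) * nthRoot n (W n β₁ β₂ γ₁ γ₂ x) - (x - β₁)

/-- `𝒜(x) = (β₁ (x - β₂) W(x)^{1/n} - β₂ (x - β₁)) / ((x - β₂) W(x)^{1/n} - (x - β₁))`. -/
noncomputable def calA (n : ℕ) (β₁ β₂ γ₁ γ₂ x : ℂ) : ℂ :=
  (β₁ * (x - β₂) * nthRoot n (W n β₁ β₂ γ₁ γ₂ x) - β₂ * (x - β₁)) / calADen n β₁ β₂ γ₁ γ₂ x

end ThueFT

/-! Put α = 1/n, let X_r be the hypergeometric polynomial of degree r (`hypVal`) and Y_r(w) = w^r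
X_r(1/w) (`hypRev`). X_r/Y_r is the Padé approximant of w^α at w = 1: the remainder w^α Y_r - X_r
vanishes there to order 2r+1. Since 𝒜 is a Möbius image of W^{1/n}, replacing W^{1/n} by
X_r(W)/Y_r(W) gives approximations P_r/R_r to 𝒜. The result follows once P_r and R_r, suitably
scaled, are rational integers with |R_r| of order Q^r and |R_r 𝒜 - P_r| of order E^{-r}, and
consecutive approximations differ (`irrationality_measure`).

Size. An integral formula (`hypRev_sub_hypVal`) bounds the remainder by a multiple of |1 - √W|^{2r}.
X_r and Y_r are bounded by multiples of |1 + √W|^{2r}: on the unit circle by Cauchy's inequality for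
a product of two binomial series, on (0,1) by comparing coefficients with binomial ones. Because |U|
|1 ± √W|² are the two numbers |u₂√t ± √(u₂²t - u₁²)|, these rates become Q and 1/E
(`min_max_norm_eq`). The bound for Y_r on (0,1) needs √W to stay away from 0, and E > 1 forces this
(`one_eighth_le_sqrt`).

Arithmetic. U^r X_r(Z/U) and U^r Y_r(Z/U) are forms of degree r in U and Z. Dividing by g^r and
multiplying by D_{n,r}/N_{d,n,r} makes them algebraic integers, since U/g, Z/g and (U - Z)/(dg) =
u₁/(dg) are integral. Conjugation sends U to -Z, so it exchanges the two forms up to (-1)^r. The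
combinations defining P_r and R_r are therefore rational for odd r and rational multiples of √t for
even r. One more factor, of size at most √|2t|, makes them rational integers (`exists_int_scale`).

Distinctness. X_r Y_{r+1} - X_{r+1} Y_r has degree at most 2r+1 and is divisible by (w - 1)^{2r+1},
so it has no other zero (`hypVal_mul_hypRev_sub_ne_zero`). -/

namespace ThueFT

section

open Finset

/-! ### Hypergeometric coefficients, and bounds for real arguments -/

/-- The coefficient of `x ^ k` in `₂F₁(-r, -r - α; 1 - α; x)`, as a product of successive ratios. -/
def hypCoeff {F : Type*} [Field F] (α : F) (r k : ℕ) : F :=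
  ∏ j ∈ range k, (((r : F) - j) * (r + α - j) / ((j + 1) * (j + 1 - α)))

lemma map_hypCoeff {F K : Type*} [Field F] [Field K] (φ : F →+* K) (α : F) (r k : ℕ) :
    φ (hypCoeff α r k) = hypCoeff (φ α) r k := by
  simp [hypCoeff]

@[norm_cast]
lemma ofReal_hypCoeff (α : ℝ) (r k : ℕ) : ((hypCoeff α r k : ℝ) : ℂ) = hypCoeff (α : ℂ) r k :=
  map_hypCoeff Complex.ofRealHom α r k

/-- `Γ(1 - α) r! / Γ(r + 1 - α)` as a finite product. -/
noncomputable def lowerFactor (α : ℝ) (r : ℕ) : ℝ := ∏ m ∈ range r, ((m + 1 : ℝ) / (m + 1 - α))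

/-- `Γ(r + 1 + α) / (Γ(1 + α) r!)` as a finite product. -/
noncomputable def upperFactor (α : ℝ) (r : ℕ) : ℝ := ∏ m ∈ range r, ((m + 1 + α) / (m + 1 : ℝ))

/-- The quotient of the generalized binomial coefficient `(r + α choose k)` by `(r choose k)`. -/
noncomputable def chooseRatio (α : ℝ) (r k : ℕ) : ℝ := ∏ j ∈ range k, (1 + α / ((r : ℝ) - j))

lemma lowerFactor_pos {α : ℝ} (h1 : α < 1) (r : ℕ) : 0 < lowerFactor α r := by
  refine prod_pos fun m _ => ?_
  have : (0 : ℝ) ≤ m := m.cast_nonneg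
  apply div_pos <;> linarith

lemma lowerFactor_mono {α : ℝ} (h0 : 0 ≤ α) (h1 : α < 1) {k r : ℕ} (hk : k ≤ r) :
    lowerFactor α k ≤ lowerFactor α r := by
  induction r, hk using Nat.le_induction with
  | base => exact le_rfl
  | succ r _ ih =>
    refine ih.trans ?_
    have : (0 : ℝ) ≤ r := r.cast_nonneg
    rw [lowerFactor, lowerFactor, prod_range_succ]
    refine le_mul_of_one_le_right (lowerFactor_pos h1 r).le ?_
    rw [one_le_div (by linarith)]; linarith

lemma upperFactor_pos {α : ℝ} (h0 : 0 ≤ α) (r : ℕ) : 0 < upperFactor α r := by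
  refine prod_pos fun m _ => ?_
  positivity

lemma chooseRatio_pos {α : ℝ} (h0 : 0 ≤ α) {r k : ℕ} (hk : k ≤ r) : 0 < chooseRatio α r k := by
  refine prod_pos fun j hj => ?_
  have : (j : ℝ) < r := by exact_mod_cast (mem_range.1 hj).trans_le hk
  have : 0 ≤ α / ((r : ℝ) - j) := div_nonneg h0 (by linarith)
  linarith

lemma cast_choose_succ {r k : ℕ} (hk : k < r) :
    (r.choose (k + 1) : ℝ) * (k + 1) = r.choose k * ((r : ℝ) - k) := by
  have := Nat.choose_succ_right_eq r k
  rw [← Nat.cast_sub hk.le]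
  exact_mod_cast this

lemma hypCoeff_eq {α : ℝ} (h1 : α < 1) {r k : ℕ} (hk : k ≤ r) :
    hypCoeff α r k = (r.choose k : ℝ) ^ 2 * chooseRatio α r k * lowerFactor α k := by
  induction k with
  | zero => simp [hypCoeff, chooseRatio, lowerFactor]
  | succ k ih =>
    have hkr : (k : ℝ) < r := by exact_mod_cast hk
    have hk0 : (0 : ℝ) ≤ k := k.cast_nonneg
    have h2 := cast_choose_succ hk
    have h3 : (r.choose (k + 1) : ℝ) = r.choose k * ((r : ℝ) - k) / (k + 1) := by
      rw [eq_div_iff (by positivity), h2]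
    rw [hypCoeff, prod_range_succ, ← hypCoeff, ih (by omega), chooseRatio, chooseRatio,
      prod_range_succ, lowerFactor, lowerFactor, prod_range_succ, h3]
    have : (r : ℝ) - k ≠ 0 := by linarith
    have : (k : ℝ) + 1 - α ≠ 0 := by linarith
    field_simp
    ring

lemma hypCoeff_pos {α : ℝ} (h0 : 0 ≤ α) (h1 : α < 1) {r k : ℕ} (hk : k ≤ r) :
    0 < hypCoeff α r k := by
  rw [hypCoeff_eq h1 hk]
  have := chooseRatio_pos h0 hk
  have := lowerFactor_pos h1 k
  have := Nat.choose_pos hk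
  positivity

/-- The left side is the generalized binomial coefficient (r + α choose k), which increases with its
upper entry, and α < 1. -/
lemma choose_mul_chooseRatio_le {α : ℝ} (h0 : 0 ≤ α) (h1 : α < 1) {r k : ℕ} (hk : k ≤ r) :
    r.choose k * chooseRatio α r k ≤ (r + 1).choose k := by
  induction k with
  | zero => simp [chooseRatio]
  | succ k ih =>
    have hkr : (k : ℝ) < r := by exact_mod_cast hk
    have hk0 : (0 : ℝ) ≤ k := k.cast_nonneg
    have h2 := cast_choose_succ hk
    have h3 := cast_choose_succ (show k < r + 1 by omega)
    push_cast at h3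
    rw [chooseRatio, prod_range_succ, ← chooseRatio]
    have h4 := ih (by omega)
    have h5 : (0 : ℝ) ≤ r.choose k * chooseRatio α r k :=
      mul_nonneg (Nat.cast_nonneg _) (chooseRatio_pos h0 (by omega)).le
    rw [← mul_le_mul_iff_left₀ (show (0 : ℝ) < k + 1 by positivity), h3]
    have h6 : ((r : ℝ) - k) * (1 + α / (r - k)) = r - k + α := by
      rw [mul_add, mul_div_cancel₀ _ (by linarith)]; ring
    calc (r.choose (k + 1) : ℝ) * (chooseRatio α r k * (1 + α / (r - k))) * (k + 1)
        = (r.choose (k + 1) : ℝ) * (k + 1) * (chooseRatio α r k * (1 + α / (r - k))) := by ring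
      _ = (r.choose k * chooseRatio α r k) * (((r : ℝ) - k) * (1 + α / (r - k))) := by
        rw [h2]; ring
      _ ≤ _ := by
        rw [h6]
        apply mul_le_mul h4 (by linarith) (by linarith) (Nat.cast_nonneg _)

/-- For α ≤ 1/3 each factor satisfies (1 + α/m)³ ≤ (2m+1)/(2m-1), and these bounds telescope. -/
lemma chooseRatio_cube_le {α : ℝ} (h0 : 0 ≤ α) (h1 : α ≤ 1 / 3) {r k : ℕ} (hk : k ≤ r) :
    chooseRatio α r k ^ 3 ≤ (2 * r + 1) / (2 * ((r : ℝ) - k) + 1) := by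
  induction k with
  | zero =>
    have : (0 : ℝ) ≤ r := r.cast_nonneg
    simp only [chooseRatio, range_zero, prod_empty, one_pow, Nat.cast_zero, sub_zero]
    rw [div_self (by linarith)]
  | succ k ih =>
    have hkr : (k : ℝ) + 1 ≤ r := by exact_mod_cast hk
    obtain ⟨m, hm⟩ : ∃ m : ℝ, m = r - k := ⟨_, rfl⟩
    have hm1 : 1 ≤ m := by linarith
    have h4 := ih (by omega)
    rw [chooseRatio, prod_range_succ, ← chooseRatio, mul_pow, Nat.cast_succ, ← sub_sub, ← hm]
    rw [← hm] at h4
    have h5 : (1 + α / m) ^ 3 ≤ (2 * m + 1) / (2 * m - 1) := by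
      have : (1 + α / m) ≤ 1 + 1 / (3 * m) := by
        rw [← div_div]; gcongr
      calc (1 + α / m) ^ 3 ≤ (1 + 1 / (3 * m)) ^ 3 := by gcongr
        _ ≤ _ := by
          rw [show 1 + 1 / (3 * m) = (3 * m + 1) / (3 * m) by field_simp, div_pow,
            div_le_div_iff₀ (by positivity) (by linarith)]
          nlinarith [sq_nonneg m]
    calc chooseRatio α r k ^ 3 * (1 + α / m) ^ 3
        ≤ (2 * r + 1) / (2 * m + 1) * ((2 * m + 1) / (2 * m - 1)) := by gcongr
      _ = _ := by
        have : 2 * (m - 1) + 1 = 2 * m - 1 := by ring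
        have : 2 * m - 1 ≠ 0 := by linarith
        rw [‹2 * (m - 1) + 1 = _›]; field_simp

/-- Linearizes the cube bound through 12c ≤ c³ + 16, that is (c - 2)²(c + 4) ≥ 0. The weight
(r+1)/(r-k+1) is chosen because binomial coefficients absorb it: (r+1)/(j+1) · (r choose j) = (r
choose j) + (r choose j+1). -/
lemma chooseRatio_le {α : ℝ} (h0 : 0 ≤ α) (h1 : α ≤ 1 / 3) {r k : ℕ} (hk : k ≤ r) :
    chooseRatio α r k ≤ (r + 1) / (6 * ((r : ℝ) - k + 1)) + 4 / 3 := by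
  have hp := chooseRatio_pos h0 hk
  have hkr : (k : ℝ) ≤ r := by exact_mod_cast hk
  have hk0 : (0 : ℝ) ≤ k := k.cast_nonneg
  have h2 : (2 * r + 1) / (2 * ((r : ℝ) - k) + 1) ≤ 12 * ((r + 1) / (6 * ((r : ℝ) - k + 1))) := by
    rw [mul_div_assoc', div_le_div_iff₀ (by linarith) (by linarith)]
    nlinarith
  have h3 := chooseRatio_cube_le h0 h1 hk
  nlinarith [mul_nonneg (sq_nonneg (chooseRatio α r k - 2))
    (show 0 ≤ chooseRatio α r k + 4 by linarith)]

lemma sum_choose_mul_pow (r : ℕ) (y : ℝ) :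
    ∑ k ∈ range (r + 1), (r.choose k : ℝ) * y ^ k = (1 + y) ^ r := by
  rw [add_comm 1 y, add_pow]
  refine sum_congr rfl fun k _ => by simp [mul_comm]

/-- The value of the hypergeometric polynomial is small on `[0, 1]`. -/
lemma sum_hypCoeff_le {α : ℝ} (h0 : 0 ≤ α) (h1 : α < 1) (r : ℕ) {y : ℝ} (hy0 : 0 ≤ y)
    (hy1 : y ≤ 1) :
    ∑ k ∈ range (r + 1), hypCoeff α r k * (y ^ 2) ^ k
      ≤ 2 * lowerFactor α r * (1 + y) ^ (2 * r) := by
  have hG := lowerFactor_pos h1 r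
  calc ∑ k ∈ range (r + 1), hypCoeff α r k * (y ^ 2) ^ k
      ≤ ∑ k ∈ range (r + 1), lowerFactor α r *
          ((r.choose k * y ^ k) * ((r + 1).choose k * y ^ k)) := by
        refine sum_le_sum fun k hk => ?_
        have hk : k ≤ r := by simpa [Nat.lt_succ_iff] using hk
        have ha := choose_mul_chooseRatio_le h0 h1 hk
        have hb := lowerFactor_mono h0 h1 hk
        rw [hypCoeff_eq h1 hk]
        calc (r.choose k : ℝ) ^ 2 * chooseRatio α r k * lowerFactor α k * (y ^ 2) ^ k
            = lowerFactor α k * ((r.choose k * y ^ k) *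
              ((r.choose k * chooseRatio α r k) * y ^ k)) := by ring
          _ ≤ _ := by
            have := lowerFactor_pos h1 k
            have := chooseRatio_pos h0 hk
            gcongr
    -- A diagonal sum of nonnegative products is at most the product of the sums. The result
    -- (1+y)^(2r+1) has one factor 1 + y ≤ 2 too many.
    _ ≤ lowerFactor α r * ((∑ k ∈ range (r + 1), r.choose k * y ^ k) *
          ∑ k ∈ range (r + 1 + 1), (r + 1).choose k * y ^ k) := by
        rw [← mul_sum]
        gcongr
        rw [sum_mul]
        refine sum_le_sum fun k hk => ?_
        gcongr
        exact single_le_sum (f := fun k => ((r + 1).choose k : ℝ) * y ^ k)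
          (fun _ _ => by positivity)
          (mem_range.2 ((mem_range.1 hk).trans (by omega)))
    _ = lowerFactor α r * ((1 + y) ^ r * (1 + y) ^ (r + 1)) := by
        rw [sum_choose_mul_pow, sum_choose_mul_pow]
    _ = (1 + y) * lowerFactor α r * (1 + y) ^ (2 * r) := by ring
    _ ≤ _ := by gcongr; linarith

/-- Expanding the square, only the diagonal and neighbouring products are kept. The neighbouring
ones pay for the extra weight in the reversed sum. -/
lemma sum_sq_add_two_mul_sum_le (a : ℕ → ℝ) (ha : ∀ i, 0 ≤ a i) (m : ℕ) :
    ∑ i ∈ range (m + 1), a i ^ 2 + 2 * ∑ i ∈ range m, a i * a (i + 1)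
      ≤ (∑ i ∈ range (m + 1), a i) ^ 2 := by
  induction m with
  | zero => simp
  | succ m ih =>
    rw [sum_range_succ (fun i => a i ^ 2) (m + 1), sum_range_succ (fun i => a i * a (i + 1)) m,
      sum_range_succ a (m + 1)]
    have : a m ≤ ∑ i ∈ range (m + 1), a i := single_le_sum (fun i _ => ha i) (by simp)
    nlinarith [mul_le_mul_of_nonneg_right this (ha (m + 1))]

/-- The reversed hypergeometric polynomial is small on an interval away from `0`. -/
lemma sum_hypCoeff_rev_le {α : ℝ} (h0 : 0 ≤ α) (h1 : α ≤ 1 / 3) (r : ℕ) {y : ℝ}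
    (hy0 : 1 / 8 ≤ y) :
    ∑ k ∈ range (r + 1), hypCoeff α r k * (y ^ 2) ^ (r - k)
      ≤ 2 * lowerFactor α r * (1 + y) ^ (2 * r) := by
  have h1' : α < 1 := by linarith
  have hG := lowerFactor_pos h1' r
  have hy : 0 < y := by linarith
  set a : ℕ → ℝ := fun j => r.choose j * y ^ j with ha
  have ha0 : ∀ j, 0 ≤ a j := fun j => by positivity
  have hS := sum_sq_add_two_mul_sum_le a ha0 r
  rw [ha, sum_choose_mul_pow, ← pow_mul, mul_comm r 2, ← ha] at hS
  -- The weight turns one of the two factors (r choose j) into (r choose j) + (r choose j+1), hence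
  -- a_j² into a_j² plus a neighbouring product divided by y.
  have hw : ∀ j ∈ range (r + 1), a j ^ 2 * ((r + 1 : ℝ) / (6 * (j + 1))) =
      (1 / 6) * (a j ^ 2 + (1 / y) * (a j * a (j + 1))) := by
    intro j _
    have h3 : ((r + 1).choose (j + 1) : ℝ) * (j + 1) = (r + 1) * r.choose j := by
      exact_mod_cast (Nat.add_one_mul_choose_eq r j).symm
    have h4 : ((r + 1).choose (j + 1) : ℝ) = r.choose j + r.choose (j + 1) := by
      exact_mod_cast Nat.choose_succ_succ r j
    have h5 : (r + 1 : ℝ) / (6 * (j + 1)) * r.choose j = (1 / 6) * (r.choose j + r.choose (j + 1)) := by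
      rw [← h4]; field_simp; linarith
    calc a j ^ 2 * ((r + 1 : ℝ) / (6 * (j + 1)))
        = r.choose j * (y ^ j) ^ 2 * ((r + 1 : ℝ) / (6 * (j + 1)) * r.choose j) := by
          simp only [ha]; ring
      _ = _ := by rw [h5]; simp only [ha]; field_simp; ring
  have hlast : a (r + 1) = 0 := by simp [ha]
  calc ∑ k ∈ range (r + 1), hypCoeff α r k * (y ^ 2) ^ (r - k)
      ≤ ∑ k ∈ range (r + 1), lowerFactor α r *
          (a (r - k) ^ 2 * ((r + 1) / (6 * ((r - k : ℕ) + 1)) + 4 / 3)) := by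
        refine sum_le_sum fun k hk => ?_
        have hk : k ≤ r := by simpa [Nat.lt_succ_iff] using hk
        have hb := lowerFactor_mono h0 h1' hk
        have hc := chooseRatio_le h0 h1 hk
        have := lowerFactor_pos h1' k
        have := chooseRatio_pos h0 hk
        rw [hypCoeff_eq h1' hk, Nat.cast_sub hk]
        simp only [ha, Nat.choose_symm hk]
        calc (r.choose k : ℝ) ^ 2 * chooseRatio α r k * lowerFactor α k * (y ^ 2) ^ (r - k)
            = lowerFactor α k * ((r.choose k * y ^ (r - k)) ^ 2 * chooseRatio α r k) := by ring
          _ ≤ _ := by gcongr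
    _ = lowerFactor α r * ∑ j ∈ range (r + 1),
          (a j ^ 2 * ((r + 1) / (6 * (j + 1)) + 4 / 3)) := by
        rw [← mul_sum, ← sum_range_reflect]
        congr 1
        refine sum_congr rfl fun k hk => ?_
        have hk : k ≤ r := by simpa [Nat.lt_succ_iff] using hk
        rw [show r + 1 - 1 - k = r - k by omega, show r - (r - k) = k by omega]
    _ = lowerFactor α r * (3 / 2 * ∑ j ∈ range (r + 1), a j ^ 2 +
          1 / (6 * y) * ∑ j ∈ range r, a j * a (j + 1)) := by
        simp_rw [mul_add (a _ ^ 2)]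
        rw [sum_add_distrib, sum_congr rfl hw, ← mul_sum, sum_add_distrib, ← mul_sum,
          sum_range_succ (fun j => a j * a (j + 1)), hlast, ← sum_mul]
        congr 1; field_simp; ring
    _ ≤ lowerFactor α r * (2 * (∑ i ∈ range (r + 1), a i ^ 2 +
          2 * ∑ i ∈ range r, a i * a (i + 1))) := by
        have hB : 0 ≤ ∑ i ∈ range r, a i * a (i + 1) :=
          sum_nonneg fun i _ => mul_nonneg (ha0 _) (ha0 _)
        have hA : 0 ≤ ∑ i ∈ range (r + 1), a i ^ 2 := sum_nonneg fun i _ => sq_nonneg _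
        -- The only place where the lower bound on y is needed.
        have : 1 / (6 * y) ≤ 4 := by rw [div_le_iff₀ (by positivity)]; linarith
        gcongr
        nlinarith [mul_le_mul_of_nonneg_right this hB]
    _ ≤ lowerFactor α r * (2 * (1 + y) ^ (2 * r)) := by gcongr
    _ = _ := by ring

/-! ### Bounds on the unit circle -/

lemma iteratedDeriv_one_add_mul_cpow (a c : ℂ) (hc : ‖c‖ ≤ 1) (k : ℕ) :
    ∀ z ∈ Metric.ball (0 : ℂ) 1, iteratedDeriv k (fun v : ℂ => (1 + c * v) ^ a) z =
      (∏ j ∈ range k, (a - j)) * c ^ k * (1 + c * z) ^ (a - k) := by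
  induction k with
  | zero => simp
  | succ k ih =>
    intro z hz
    have hz' : ‖c * z‖ < 1 := by
      rw [norm_mul]
      have : ‖z‖ < 1 := by simpa using hz
      nlinarith [norm_nonneg z, norm_nonneg c]
    have hev : iteratedDeriv k (fun v : ℂ => (1 + c * v) ^ a) =ᶠ[nhds z]
        fun z => (∏ j ∈ range k, (a - j)) * c ^ k * (1 + c * z) ^ (a - k) :=
      Filter.eventually_of_mem (Metric.isOpen_ball.mem_nhds hz) ih
    have hs : 1 + c * z ∈ Complex.slitPlane := Complex.mem_slitPlane_of_norm_lt_one hz'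
    have hd : HasDerivAt (fun v : ℂ => 1 + c * v) c z := by
      simpa using ((hasDerivAt_id z).const_mul c).const_add 1
    rw [iteratedDeriv_succ, hev.deriv_eq,
      ((hd.cpow_const (c := a - k) hs).const_mul ((∏ j ∈ range k, (a - j)) * c ^ k)).deriv,
      prod_range_succ, show a - ((k + 1 : ℕ) : ℂ) = a - k - 1 by push_cast; ring]
    ring

/-- As y has modulus 1, 1 + y² = 2y Re y. The product is thus 1 + y²v² + 2vy Re y, and the triangle
inequality gives 2 + 2 Re y = ‖1 + y‖². -/
lemma norm_one_add_mul_one_add_le {y : ℂ} (hy : ‖y‖ = 1) (hre : 0 ≤ y.re) {v : ℂ} (hv : ‖v‖ ≤ 1) :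
    ‖1 + y ^ 2 * v‖ * ‖1 + v‖ ≤ ‖1 + y‖ ^ 2 := by
  have hn : Complex.normSq y = 1 := by rw [Complex.normSq_eq_norm_sq, hy]; norm_num
  have h1 : ‖1 + y‖ ^ 2 = 2 + 2 * y.re := by
    rw [← Complex.normSq_eq_norm_sq, Complex.normSq_add, hn]; simp; ring
  have hc : y * (starRingEnd ℂ) y = 1 := by rw [Complex.mul_conj, hn]; simp
  have h2 : (1 + y ^ 2 * v) * (1 + v) = 1 + y ^ 2 * v * v + v * y * (2 * y.re : ℝ) := by
    rw [← Complex.add_conj]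
    linear_combination (-v) * hc
  rw [← norm_mul, h2, h1]
  refine (norm_add₃_le).trans ?_
  have h3 : ‖((2 * y.re : ℝ) : ℂ)‖ = 2 * y.re := by
    rw [Complex.norm_real, Real.norm_of_nonneg (by linarith)]
  rw [norm_mul, norm_mul, norm_mul, norm_mul, norm_pow, hy, norm_one, h3]
  nlinarith [norm_nonneg v]

/-- The coefficient of a product of two binomial series, estimated by Cauchy's inequality. -/
lemma norm_sum_choose_le {α : ℝ} (h0 : 0 ≤ α) (h1 : α ≤ 1 / 2) {r : ℕ} (hr : 1 ≤ r) {y : ℂ}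
    (hy : ‖y‖ = 1) (hre : 0 ≤ y.re) :
    ‖∑ k ∈ range (r + 1), (r.choose k : ℂ) * ((∏ j ∈ range k, ((r + α : ℂ) - j)) * (y ^ 2) ^ k) *
      ∏ j ∈ range (r - k), ((r - α : ℂ) - j)‖ ≤ r.factorial * (2 * ‖1 + y‖ ^ (2 * r)) := by
  have hn : Complex.normSq y = 1 := by rw [Complex.normSq_eq_norm_sq, hy]; norm_num
  have hM : 2 ≤ ‖1 + y‖ ^ 2 := by
    rw [← Complex.normSq_eq_norm_sq, Complex.normSq_add, hn]; simp; linarith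
  have hW : ‖y ^ 2‖ = 1 := by rw [norm_pow, hy]; norm_num
  set f : ℂ → ℂ := fun v => (1 + y ^ 2 * v) ^ (r + α : ℂ) with hf
  set h : ℂ → ℂ := fun v => (1 + 1 * v) ^ (r - α : ℂ) with hh
  have hslit : ∀ c : ℂ, ‖c‖ = 1 → ∀ z : ℂ, ‖z‖ < 1 → 1 + c * z ∈ Complex.slitPlane := by
    intro c hc z hz
    exact Complex.mem_slitPlane_of_norm_lt_one (by rwa [norm_mul, hc, one_mul])
  have hfd : ∀ z : ℂ, ‖z‖ < 1 → DifferentiableAt ℂ f z := fun z hz =>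
    (by fun_prop : DifferentiableAt ℂ (fun v : ℂ => 1 + y ^ 2 * v) z).cpow_const (hslit _ hW z hz)
  have hhd : ∀ z : ℂ, ‖z‖ < 1 → DifferentiableAt ℂ h z := fun z hz =>
    (by fun_prop : DifferentiableAt ℂ (fun v : ℂ => 1 + 1 * v) z).cpow_const
      (hslit _ norm_one z hz)
  have hfc : ContDiffAt ℂ r f 0 :=
    (DifferentiableOn.analyticAt (s := Metric.ball 0 1)
      (fun z hz => (hfd z (by simpa using hz)).differentiableWithinAt)
      (Metric.ball_mem_nhds 0 one_pos)).contDiffAt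
  have hhc : ContDiffAt ℂ r h 0 :=
    (DifferentiableOn.analyticAt (s := Metric.ball 0 1)
      (fun z hz => (hhd z (by simpa using hz)).differentiableWithinAt)
      (Metric.ball_mem_nhds 0 one_pos)).contDiffAt
  have hder := iteratedDeriv_mul hfc hhc
  have h0b : (0 : ℂ) ∈ Metric.ball (0 : ℂ) 1 := by simp
  have heq : iteratedDeriv r (f * h) 0 = ∑ k ∈ range (r + 1), (r.choose k : ℂ) *
      ((∏ j ∈ range k, ((r + α : ℂ) - j)) * (y ^ 2) ^ k) *
      ∏ j ∈ range (r - k), ((r - α : ℂ) - j) := by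
    rw [hder]
    refine sum_congr rfl fun k _ => ?_
    rw [hf, hh, iteratedDeriv_one_add_mul_cpow _ _ hW.le _ _ h0b,
      iteratedDeriv_one_add_mul_cpow _ _ norm_one.le _ _ h0b]
    simp
  rw [← heq]
  -- With a, b the moduli of the two linear factors and M = ‖1 + y‖², write a^(r+α) b^(r-α) =
  -- (ab)^(r-α) (a²)^α. Here ab ≤ M and a² ≤ 4 ≤ 2M, while r ≥ 1 makes the exponent r - α
  -- nonnegative.
  have hbound : ∀ z : ℂ, ‖z‖ < 1 → ‖(f * h) z‖ ≤ 2 * ‖1 + y‖ ^ (2 * r) := by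
    intro z hz
    have hA0 : 0 < ‖1 + y ^ 2 * z‖ := norm_pos_iff.2 (Complex.slitPlane_ne_zero (hslit _ hW z hz))
    have hB0 : 0 < ‖1 + z‖ := norm_pos_iff.2 (Complex.slitPlane_ne_zero (by
      simpa using hslit _ norm_one z hz))
    have hA2 : ‖1 + y ^ 2 * z‖ ≤ 2 := by
      refine (norm_add_le _ _).trans ?_
      rw [norm_mul, hW, norm_one]; linarith
    have hAB := norm_one_add_mul_one_add_le hy hre hz.le
    set a := ‖1 + y ^ 2 * z‖
    set b := ‖1 + z‖
    set M := ‖1 + y‖ ^ 2 with hMdef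
    have hr1 : (1 : ℝ) ≤ r := by exact_mod_cast hr
    have e1 : ‖f z‖ = a ^ ((r : ℝ) + α) := by
      rw [hf, show (r + α : ℂ) = ((r + α : ℝ) : ℂ) by push_cast; rfl]
      exact Complex.norm_cpow_real _ _
    have e2 : ‖h z‖ = b ^ ((r : ℝ) - α) := by
      rw [hh, show (r - α : ℂ) = ((r - α : ℝ) : ℂ) by push_cast; rfl]
      simp only [one_mul]
      exact Complex.norm_cpow_real _ _
    have hM0 : 0 < M := by linarith
    calc ‖(f * h) z‖ = a ^ ((r : ℝ) + α) * b ^ ((r : ℝ) - α) := by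
          rw [Pi.mul_apply, norm_mul, e1, e2]
      _ = (a * b) ^ ((r : ℝ) - α) * a ^ (2 * α) := by
          rw [Real.mul_rpow hA0.le hB0.le, mul_right_comm, ← Real.rpow_add hA0]
          congr 2; ring
      _ ≤ M ^ ((r : ℝ) - α) * (M * 2) ^ α := by
          have : a ^ (2 * α) ≤ (M * 2) ^ α := by
            rw [Real.rpow_mul hA0.le]
            refine Real.rpow_le_rpow (by positivity) ?_ h0
            rw [Real.rpow_two]; nlinarith
          refine mul_le_mul (Real.rpow_le_rpow (by positivity) hAB (by linarith)) this
            (by positivity) (by positivity)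
      _ = 2 ^ α * M ^ r := by
          rw [Real.mul_rpow hM0.le (by norm_num), ← mul_assoc, ← Real.rpow_add hM0,
            sub_add_cancel, Real.rpow_natCast]; ring
      _ ≤ 2 * M ^ r := by
          gcongr
          calc (2 : ℝ) ^ α ≤ 2 ^ (1 : ℝ) :=
                Real.rpow_le_rpow_of_exponent_le (by norm_num) (by linarith)
            _ = 2 := by norm_num
      _ = 2 * ‖1 + y‖ ^ (2 * r) := by rw [hMdef, ← pow_mul]
  -- The binomial powers can branch on the unit circle, so Cauchy's inequality is applied at radius
  -- R < 1, and then R tends to 1.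
  have hC : ∀ R : ℝ, 0 < R → R < 1 → R ^ r * ‖iteratedDeriv r (f * h) 0‖ ≤
      r.factorial * (2 * ‖1 + y‖ ^ (2 * r)) := by
    intro R hR0 hR1
    have hcl : ∀ z ∈ Metric.closedBall (0 : ℂ) R, ‖z‖ < 1 := fun z hz =>
      lt_of_le_of_lt (by simpa using hz) hR1
    have hd : DifferentiableOn ℂ (f * h) (Metric.closedBall (0 : ℂ) R) := fun z hz =>
      ((hfd z (hcl z hz)).mul (hhd z (hcl z hz))).differentiableWithinAt
    have := Complex.norm_iteratedDeriv_le_of_forall_mem_sphere_norm_le r hR0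
      (f := f * h) (c := 0) (C := 2 * ‖1 + y‖ ^ (2 * r))
      (DifferentiableOn.diffContOnCl (by rwa [closure_ball _ hR0.ne']))
      (fun z hz => hbound z (hcl z (Metric.sphere_subset_closedBall hz)))
    rw [le_div_iff₀ (by positivity)] at this
    linarith
  have hlim : Filter.Tendsto (fun R : ℝ => R ^ r * ‖iteratedDeriv r (f * h) 0‖)
      (nhdsWithin 1 (Set.Iio 1)) (nhds (1 ^ r * ‖iteratedDeriv r (f * h) 0‖)) :=
    ((Continuous.tendsto (by fun_prop) 1)).mono_left nhdsWithin_le_nhds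
  rw [one_pow, one_mul] at hlim
  refine le_of_tendsto hlim ?_
  filter_upwards [Ioo_mem_nhdsLT (show (0 : ℝ) < 1 by norm_num)] with R hR
  exact hC R hR.1 hR.2

/-- Identifies the coefficient with a Leibniz term of the r-th derivative at 0 of (1 + y²v)^(r+α) (1
+ v)^(r-α), so that the Cauchy estimate above bounds the hypergeometric polynomial. -/
lemma factorial_mul_hypCoeff {α : ℝ} (h1 : α < 1) {r k : ℕ} (hk : k ≤ r) :
    r.factorial * hypCoeff α r k = lowerFactor α r *
      (r.choose k * (∏ j ∈ range k, (r + α - j)) * ∏ j ∈ range (r - k), (r - α - j)) := by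
  induction k with
  | zero =>
    simp only [hypCoeff, range_zero, prod_empty, Nat.choose_zero_right, Nat.sub_zero, lowerFactor]
    rw [← prod_range_reflect (fun j => (r : ℝ) - α - j), Nat.cast_one, one_mul, one_mul,
      ← prod_mul_distrib, mul_one, ← prod_range_add_one_eq_factorial, Nat.cast_prod]
    refine prod_congr rfl fun j hj => ?_
    have hj := mem_range.1 hj
    rw [show r - 1 - j = r - (j + 1) by omega, Nat.cast_sub (by omega)]
    have : (0 : ℝ) ≤ j := j.cast_nonneg
    have : (j : ℝ) + 1 - α ≠ 0 := by linarith
    push_cast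
    field_simp
    ring
  | succ k ih =>
    have hk0 : (0 : ℝ) ≤ k := k.cast_nonneg
    have h2 := cast_choose_succ hk
    have h3 : (r.choose (k + 1) : ℝ) = r.choose k * ((r : ℝ) - k) / (k + 1) := by
      rw [eq_div_iff (by positivity), h2]
    have h4 := ih (by omega)
    rw [show r - k = r - (k + 1) + 1 by omega, prod_range_succ, Nat.cast_sub hk] at h4
    have h5 : (r : ℝ) - α - (r - ((k + 1 : ℕ) : ℝ)) = k + 1 - α := by push_cast; ring
    rw [h5] at h4
    rw [hypCoeff, prod_range_succ, ← hypCoeff, ← mul_assoc, h4, prod_range_succ _ k, h3]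
    have : (k : ℝ) + 1 - α ≠ 0 := by linarith
    field_simp

lemma norm_sum_hypCoeff_le {α : ℝ} (h0 : 0 ≤ α) (h1 : α ≤ 1 / 2) (r : ℕ) {y : ℂ}
    (hy : ‖y‖ = 1) (hre : 0 ≤ y.re) :
    ‖∑ k ∈ range (r + 1), hypCoeff (α : ℂ) r k * (y ^ 2) ^ k‖
      ≤ 2 * lowerFactor α r * ‖1 + y‖ ^ (2 * r) := by
  rcases Nat.eq_zero_or_pos r with rfl | hr
  · simp [hypCoeff, lowerFactor]
  have hG := lowerFactor_pos (show α < 1 by linarith) r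
  have hf : (0 : ℝ) < r.factorial := by positivity
  have key := norm_sum_choose_le h0 h1 hr hy hre
  have heq : (r.factorial : ℂ) * ∑ k ∈ range (r + 1), hypCoeff (α : ℂ) r k * (y ^ 2) ^ k =
      lowerFactor α r * ∑ k ∈ range (r + 1), (r.choose k : ℂ) *
      ((∏ j ∈ range k, ((r + α : ℂ) - j)) * (y ^ 2) ^ k) *
      ∏ j ∈ range (r - k), ((r - α : ℂ) - j) := by
    rw [mul_sum, mul_sum]
    refine sum_congr rfl fun k hk => ?_
    have hk : k ≤ r := by simpa [Nat.lt_succ_iff] using hk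
    have := congrArg (fun x : ℝ => (x : ℂ)) (factorial_mul_hypCoeff (show α < 1 by linarith) hk)
    push_cast at this
    linear_combination (y ^ 2) ^ k * this
  have hnorm := congrArg norm heq
  rw [norm_mul, norm_mul, Complex.norm_natCast, Complex.norm_real, Real.norm_of_nonneg hG.le]
    at hnorm
  rw [← mul_le_mul_iff_right₀ hf, hnorm]
  calc _ ≤ lowerFactor α r * (r.factorial * (2 * ‖1 + y‖ ^ (2 * r))) := by gcongr
    _ = _ := by ring

/-! ### The Padé remainder -/

/-- The polynomial `₂F₁(-r, -r - α; 1 - α; w)`. -/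
noncomputable def hypVal (α : ℝ) (r : ℕ) (w : ℂ) : ℂ :=
  ∑ k ∈ range (r + 1), hypCoeff (α : ℂ) r k * w ^ k

/-- The polynomial `w ^ r ₂F₁(-r, -r - α; 1 - α; 1 / w)`. -/
noncomputable def hypRev (α : ℝ) (r : ℕ) (w : ℂ) : ℂ :=
  ∑ k ∈ range (r + 1), hypCoeff (α : ℂ) r k * w ^ (r - k)

/-- Partial fractions. Pascal's rule expresses the sum for r + 1 at x as the difference of the sums
for r at x and at x - 1. -/
lemma sum_alternating_choose_div {F : Type*} [Field F] (r : ℕ) :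
    ∀ x : F, (∀ j : ℕ, x ≠ j) → ∑ j ∈ range (r + 1), (-1) ^ j * (r.choose j : F) / (x - j) =
      (-1) ^ r * r.factorial / ∏ j ∈ range (r + 1), (x - j) := by
  induction r with
  | zero => intro x _; simp
  | succ r ih =>
    intro x hx
    have hx' : ∀ j : ℕ, x - 1 ≠ j := fun j h => hx (j + 1) (by push_cast; linear_combination h)
    have h1 := Finset.sum_choose_succ_mul (R := F) (fun j _ => (-1) ^ j / (x - j)) r
    have h2 : ∑ j ∈ range (r + 1 + 1), (-1) ^ j * ((r + 1).choose j : F) / (x - j) =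
        ∑ j ∈ range (r + 1), (-1) ^ j * (r.choose j : F) / (x - j) -
        ∑ j ∈ range (r + 1), (-1) ^ j * (r.choose j : F) / (x - 1 - j) := by
      calc _ = ∑ j ∈ range (r + 2), ((r + 1).choose j : F) * ((-1) ^ j / (x - j)) :=
            sum_congr rfl fun j _ => by ring
        _ = _ := by
          rw [h1, sub_eq_add_neg, ← sum_neg_distrib]
          congr 1
          · exact sum_congr rfl fun j _ => by ring
          · refine sum_congr rfl fun j _ => ?_
            rw [show x - ((j + 1 : ℕ) : F) = x - 1 - j by push_cast; ring]; ring
    have hA : ∏ j ∈ range r, (x - ((j + 1 : ℕ) : F)) ≠ 0 :=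
      prod_ne_zero_iff.2 fun j _ => sub_ne_zero.2 (hx _)
    have hshift : ∀ j : ℕ, x - 1 - (j : F) = x - ((j + 1 : ℕ) : F) := fun j => by push_cast; ring
    rw [h2, ih x hx, ih (x - 1) hx']
    simp_rw [hshift]
    rw [prod_range_succ' _ (r + 1), prod_range_succ' _ r, prod_range_succ _ r]
    have h0 : x - ((0 : ℕ) : F) ≠ 0 := sub_ne_zero.2 (hx 0)
    have hr : x - ((r + 1 : ℕ) : F) ≠ 0 := sub_ne_zero.2 (hx _)
    rw [Nat.factorial_succ]
    field_simp
    push_cast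
    ring

/-- Puts the coefficient in the shape that partial fractions of 1/∏(i + α - k) produce. Passing from
k to k + 1 shifts the product by one factor. -/
lemma hypCoeff_mul_prod {α : ℝ} (h0 : 0 < α) (h1 : α < 1) {r k : ℕ} (hk : k ≤ r) :
    hypCoeff α r k * ∏ i ∈ range (r + 1), (i + α - k) =
      (-1) ^ k * r.choose k * ∏ i ∈ range (r + 1), (i + α) := by
  induction k with
  | zero => simp [hypCoeff]
  | succ k ih =>
    have hkr : (k : ℝ) < r := by exact_mod_cast hk
    have hk0 : (0 : ℝ) ≤ k := k.cast_nonneg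
    have h2 := cast_choose_succ hk
    have h3 : (r.choose (k + 1) : ℝ) = r.choose k * ((r : ℝ) - k) / (k + 1) := by
      rw [eq_div_iff (by positivity), h2]
    have h4 := ih (by omega)
    have hne : (r : ℝ) + α - k ≠ 0 := by linarith
    have h5 : (∏ i ∈ range (r + 1), ((i : ℝ) + α - ((k + 1 : ℕ) : ℝ))) * (r + α - k) =
        (∏ i ∈ range (r + 1), ((i : ℝ) + α - k)) * (α - (k + 1)) := by
      rw [prod_range_succ', prod_range_succ _ r]
      have : ∀ i : ℕ, ((i + 1 : ℕ) : ℝ) + α - ((k + 1 : ℕ) : ℝ) = i + α - k := fun i => by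
        push_cast; ring
      simp_rw [this]
      push_cast; ring
    rw [hypCoeff, prod_range_succ, ← hypCoeff, h3, pow_succ]
    have : (k : ℝ) + 1 - α ≠ 0 := by linarith
    rw [← mul_left_inj' hne, mul_assoc, h5]
    calc _ = -(hypCoeff α r k * ∏ i ∈ range (r + 1), ((i : ℝ) + α - k)) *
          ((r - k) * (r + α - k) / (k + 1)) := by field_simp; ring
      _ = _ := by rw [h4]; ring

lemma add_sub_ne_zero {α : ℝ} (h0 : 0 < α) (h1 : α < 1) (i j : ℕ) : (i : ℂ) + α - j ≠ 0 := by
  intro h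
  have h' : (i : ℝ) + α - j = 0 := by exact_mod_cast h
  have h2 : α = ((j - i : ℤ) : ℝ) := by push_cast; linarith
  rw [h2] at h0 h1
  have h3 : (0 : ℤ) < (j - i : ℤ) := by exact_mod_cast h0
  have h4 : (j - i : ℤ) < 1 := by exact_mod_cast h1
  omega

/-- An integral formula for the error of the Padé approximation to `w ^ α` at `w = 1`. -/
lemma hypRev_sub_hypVal {α : ℝ} (h0 : 0 < α) (h1 : α < 1) (r : ℕ) {ζ : ℂ} (hζ : ζ ≠ 0) :
    Complex.exp (ζ * α) * hypRev α r (Complex.exp ζ) - hypVal α r (Complex.exp ζ) =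
      ((∏ i ∈ range (r + 1), (i + α) : ℝ) / r.factorial : ℂ) * (ζ * ∫ s in (0 : ℝ)..1,
        ((1 - Complex.exp (ζ * s)) * (1 - Complex.exp (ζ * (1 - s)))) ^ r
          * Complex.exp (ζ * α * s)) := by
  have hne := add_sub_ne_zero h0 h1
  set w := Complex.exp ζ with hw
  set ω := Complex.exp (ζ * α) with hω
  -- Expand both r-th powers by the binomial theorem and integrate each exponential. No denominator
  -- i + α - j vanishes, because α is not an integer.
  have hint : ζ * ∫ s in (0 : ℝ)..1, ((1 - Complex.exp (ζ * s)) * (1 - Complex.exp (ζ * (1 - s)))) ^ r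
          * Complex.exp (ζ * α * s) = ∑ i ∈ range (r + 1), ∑ j ∈ range (r + 1),
      ((-1) ^ i * r.choose i : ℂ) * ((-1) ^ j * r.choose j) * ((w ^ i * ω - w ^ j) / (i + α - j)) := by
    have hpt : ∀ s : ℝ, ((1 - Complex.exp (ζ * s)) * (1 - Complex.exp (ζ * (1 - s)))) ^ r
          * Complex.exp (ζ * α * s) = ∑ i ∈ range (r + 1), ∑ j ∈ range (r + 1),
        ((-1) ^ i * r.choose i : ℂ) * ((-1) ^ j * r.choose j) *
          (w ^ j * Complex.exp (ζ * (i + α - j) * s)) := by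
      intro s
      have hb : ∀ z : ℂ, (1 - z) ^ r = ∑ i ∈ range (r + 1), ((-1) ^ i * r.choose i : ℂ) * z ^ i := by
        intro z
        rw [show 1 - z = -z + 1 by ring, add_pow]
        exact sum_congr rfl fun i _ => by rw [neg_pow]; ring
      rw [mul_pow, hb, hb, sum_mul_sum, sum_mul]
      refine sum_congr rfl fun i _ => ?_
      rw [sum_mul]
      refine sum_congr rfl fun j _ => ?_
      have : Complex.exp (ζ * s) ^ i * Complex.exp (ζ * (1 - s)) ^ j * Complex.exp (ζ * α * s) =
          w ^ j * Complex.exp (ζ * (i + α - j) * s) := by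
        rw [hw, ← Complex.exp_nat_mul, ← Complex.exp_nat_mul, ← Complex.exp_nat_mul,
          ← Complex.exp_add, ← Complex.exp_add, ← Complex.exp_add]
        congr 1; ring
      rw [← this]; ring
    simp_rw [hpt]
    rw [intervalIntegral.integral_finsetSum
      (fun i _ => Continuous.intervalIntegrable (by fun_prop) _ _), mul_sum]
    refine sum_congr rfl fun i _ => ?_
    rw [intervalIntegral.integral_finsetSum
      (fun i _ => Continuous.intervalIntegrable (by fun_prop) _ _), mul_sum]
    refine sum_congr rfl fun j _ => ?_
    rw [intervalIntegral.integral_const_mul, intervalIntegral.integral_const_mul,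
      integral_exp_mul_complex (mul_ne_zero hζ (hne i j))]
    have h3 : w ^ j * Complex.exp (ζ * (i + α - j)) = w ^ i * ω := by
      rw [hw, hω, ← Complex.exp_nat_mul, ← Complex.exp_nat_mul, ← Complex.exp_add,
        ← Complex.exp_add]
      congr 1; ring
    have h4 := hne i j
    simp only [Complex.ofReal_one, Complex.ofReal_zero, mul_one, mul_zero, Complex.exp_zero]
    rw [← h3]
    field_simp
  have hco : ∀ k ≤ r, hypCoeff (α : ℂ) r k = ((∏ i ∈ range (r + 1), (i + α) : ℝ) : ℂ) *
      ((-1) ^ k * r.choose k / ∏ i ∈ range (r + 1), ((i : ℂ) + α - k)) := by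
    intro k hk
    rw [mul_div_assoc', eq_div_iff (prod_ne_zero_iff.2 fun i _ => hne i k)]
    have := congrArg (fun x : ℝ => (x : ℂ)) (hypCoeff_mul_prod h0 h1 hk)
    push_cast at this ⊢
    linear_combination this
  have hf : (r.factorial : ℂ) ≠ 0 := by exact_mod_cast r.factorial_ne_zero
  have hA : ∀ i : ℕ, i ≤ r → ∑ j ∈ range (r + 1), (-1) ^ j * (r.choose j : ℂ) / (i + α - j) =
      (-1) ^ r * r.factorial / ∏ j ∈ range (r + 1), ((j : ℂ) + α - (r - i : ℕ)) := by
    intro i hi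
    rw [sum_alternating_choose_div r (i + α : ℂ) (fun j => sub_ne_zero.1 (hne i j)),
      ← prod_range_reflect]
    congr 1
    refine prod_congr rfl fun j hj => ?_
    have hj : j ≤ r := by simpa [Nat.lt_succ_iff] using hj
    rw [show r + 1 - 1 - j = r - j by omega, Nat.cast_sub hj, Nat.cast_sub hi]
    ring
  have hB : ∀ j : ℕ, ∑ i ∈ range (r + 1), (-1) ^ i * (r.choose i : ℂ) / (i + α - j) =
      r.factorial / ∏ i ∈ range (r + 1), ((i : ℂ) + α - j) := by
    intro j
    have := sum_alternating_choose_div r (j - α : ℂ) (fun i h => hne i j (by rw [← h]; ring))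
    have h5 : ∏ i ∈ range (r + 1), ((j : ℂ) - α - i) =
        (-1) ^ (r + 1) * ∏ i ∈ range (r + 1), ((i : ℂ) + α - j) := by
      have : ∀ i : ℕ, (j : ℂ) - α - i = -1 * (i + α - j) := fun i => by ring
      simp_rw [this]
      rw [prod_mul_distrib, prod_const, card_range]
    have h6 : ∑ i ∈ range (r + 1), (-1) ^ i * (r.choose i : ℂ) / (i + α - j) =
        -∑ i ∈ range (r + 1), (-1) ^ i * (r.choose i : ℂ) / (j - α - i) := by
      rw [← sum_neg_distrib]
      refine sum_congr rfl fun i _ => ?_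
      rw [show (j : ℂ) - α - i = -(i + α - j) by ring, div_neg, neg_neg]
    rw [h6, this, h5, pow_succ]
    have h7 : ((-1 : ℂ)) ^ r ≠ 0 := by simp
    have h8 : ∏ i ∈ range (r + 1), ((i : ℂ) + α - j) ≠ 0 := prod_ne_zero_iff.2 fun i _ => hne i j
    field_simp
  -- In the part containing ω = e^{ζα} the sum over j is a partial fraction sum and gives the
  -- coefficients of Y_r. In the other part the sum over i gives those of X_r.
  have hsplit : ∑ i ∈ range (r + 1), ∑ j ∈ range (r + 1),
      ((-1) ^ i * r.choose i : ℂ) * ((-1) ^ j * r.choose j) * ((w ^ i * ω - w ^ j) / (i + α - j)) =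
      ω * ∑ i ∈ range (r + 1), ((-1) ^ i * r.choose i : ℂ) * w ^ i *
        ∑ j ∈ range (r + 1), (-1) ^ j * (r.choose j : ℂ) / (i + α - j) -
      ∑ j ∈ range (r + 1), ((-1) ^ j * r.choose j : ℂ) * w ^ j *
        ∑ i ∈ range (r + 1), (-1) ^ i * (r.choose i : ℂ) / (i + α - j) := by
    simp_rw [mul_sum]
    conv_rhs => rw [sum_comm (s := range (r + 1)) (t := range (r + 1))
      (f := fun j i => ((-1) ^ j * r.choose j : ℂ) * w ^ j *
        ((-1) ^ i * (r.choose i : ℂ) / (i + α - j)))]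
    rw [← sum_sub_distrib]
    refine sum_congr rfl fun i _ => ?_
    rw [← sum_sub_distrib]
    refine sum_congr rfl fun j _ => ?_
    ring
  rw [hint, hsplit, mul_sub, hypRev, hypVal]
  congr 1
  · rw [mul_left_comm]
    congr 1
    rw [← sum_range_reflect, mul_sum]
    refine sum_congr rfl fun i hi => ?_
    have hi : i ≤ r := by simpa [Nat.lt_succ_iff] using hi
    rw [show r + 1 - 1 - i = r - i by omega, show r - (r - i) = i by omega, hA i hi,
      hco _ (Nat.sub_le r i), Nat.choose_symm hi]
    have : (-1 : ℂ) ^ (r - i) = (-1) ^ i * (-1) ^ r := by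
      rw [← pow_add, show i + r = (r - i) + 2 * i by omega, pow_add, pow_mul]; simp
    rw [this]
    field_simp
  · rw [mul_sum]
    refine sum_congr rfl fun i hi => ?_
    have hi : i ≤ r := by simpa [Nat.lt_succ_iff] using hi
    rw [hB, hco i hi]
    field_simp

lemma prod_add_eq {α : ℝ} (r : ℕ) :
    (∏ i ∈ range (r + 1), ((i : ℝ) + α)) = α * (r.factorial * upperFactor α r) := by
  rw [prod_range_succ', upperFactor, ← prod_range_add_one_eq_factorial, Nat.cast_prod,
    ← prod_mul_distrib, mul_comm]
  congr 1
  · simp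
  refine prod_congr rfl fun i _ => ?_
  push_cast
  field_simp

lemma norm_hypRev_sub_hypVal_le {α : ℝ} (h0 : 0 < α) (h1 : α < 1) (r : ℕ) {ζ : ℂ} (hζ : ζ ≠ 0)
    {m : ℝ} (hm : ∀ s ∈ Set.Icc (0 : ℝ) 1,
      ‖(1 - Complex.exp (ζ * s)) * (1 - Complex.exp (ζ * (1 - s)))‖ ≤ m) :
    ‖Complex.exp (ζ * α) * hypRev α r (Complex.exp ζ) - hypVal α r (Complex.exp ζ)‖ ≤
      upperFactor α r * m ^ r * (α * ‖ζ‖ * ∫ s in (0 : ℝ)..1, Real.exp (ζ.re * α * s)) := by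
  have hH := upperFactor_pos h0.le r
  have hnorm : ∀ s : ℝ, ‖Complex.exp (ζ * α * s)‖ = Real.exp (ζ.re * α * s) := by
    intro s
    rw [Complex.norm_exp]; simp
  have hI : ‖∫ s in (0 : ℝ)..1, ((1 - Complex.exp (ζ * s)) * (1 - Complex.exp (ζ * (1 - s)))) ^ r
          * Complex.exp (ζ * α * s)‖ ≤ m ^ r * ∫ s in (0 : ℝ)..1, Real.exp (ζ.re * α * s) := by
    rw [← intervalIntegral.integral_const_mul]
    refine intervalIntegral.norm_integral_le_of_norm_le zero_le_one ?_
      (Continuous.intervalIntegrable (by fun_prop) _ _)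
    refine Filter.Eventually.of_forall fun s hs => ?_
    rw [norm_mul, norm_pow, hnorm]
    have := hm s ⟨hs.1.le, hs.2⟩
    gcongr
  rw [hypRev_sub_hypVal h0 h1 r hζ, norm_mul, norm_mul, prod_add_eq]
  have hf : (0 : ℝ) < r.factorial := by positivity
  have hK : ‖(((α * (r.factorial * upperFactor α r) : ℝ) : ℂ) / r.factorial)‖ =
      α * upperFactor α r := by
    rw [norm_div, Complex.norm_natCast, Complex.norm_real, Real.norm_of_nonneg (by positivity)]
    field_simp
  rw [hK]
  calc _ ≤ α * upperFactor α r * (‖ζ‖ * (m ^ r * ∫ s in (0 : ℝ)..1, Real.exp (ζ.re * α * s))) := by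
        gcongr
    _ = _ := by ring

/-- Shows the symmetry s ↔ 1 - s of the integrand. For real or purely imaginary ζ (within |ζ| ≤ π)
the modulus is then largest at s = 1/2, where it equals ‖1 - e^{ζ/2}‖². -/
lemma one_sub_exp_mul (ζ : ℂ) (s : ℂ) :
    (1 - Complex.exp (ζ * s)) * (1 - Complex.exp (ζ * (1 - s))) =
      2 * Complex.exp (ζ / 2) * (Complex.cosh (ζ / 2) - Complex.cosh (ζ * (s - 1 / 2))) := by
  rw [Complex.cosh, Complex.cosh]
  have e1 : Complex.exp (ζ / 2) * Complex.exp (ζ / 2) = Complex.exp ζ := by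
    rw [← Complex.exp_add]; ring_nf
  have e2 : Complex.exp (ζ / 2) * Complex.exp (-(ζ / 2)) = 1 := by
    rw [← Complex.exp_add]; simp
  have e3 : Complex.exp (ζ / 2) * Complex.exp (ζ * (s - 1 / 2)) = Complex.exp (ζ * s) := by
    rw [← Complex.exp_add]; ring_nf
  have e4 : Complex.exp (ζ / 2) * Complex.exp (-(ζ * (s - 1 / 2))) = Complex.exp (ζ * (1 - s)) := by
    rw [← Complex.exp_add]; ring_nf
  have e5 : Complex.exp (ζ * s) * Complex.exp (ζ * (1 - s)) = Complex.exp ζ := by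
    rw [← Complex.exp_add]; ring_nf
  linear_combination e5 - e1 - e2 + e3 + e4

lemma one_sub_exp_half_sq (ζ : ℂ) :
    (1 - Complex.exp (ζ / 2)) ^ 2 = 2 * Complex.exp (ζ / 2) * (Complex.cosh (ζ / 2) - 1) := by
  have := one_sub_exp_mul ζ (1 / 2)
  simp only [sub_self, mul_zero, Complex.cosh_zero] at this
  rw [← this]; ring_nf

/-- The error of the Padé approximation to `w ^ α` for real `0 < w < 1`. -/
lemma norm_remainder_le_of_neg {α : ℝ} (h0 : 0 < α) (h1 : α < 1) (r : ℕ) {τ : ℝ} (hτ : τ < 0) :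
    ‖Complex.exp (τ * α) * hypRev α r (Complex.exp τ) - hypVal α r (Complex.exp τ)‖ ≤
      upperFactor α r * ‖1 - Complex.exp (τ / 2)‖ ^ (2 * r) * ‖1 - Complex.exp (τ * α)‖ := by
  have hm : ∀ s ∈ Set.Icc (0 : ℝ) 1, ‖(1 - Complex.exp (τ * s)) * (1 - Complex.exp (τ * (1 - s)))‖
      ≤ ‖1 - Complex.exp (τ / 2)‖ ^ 2 := by
    intro s hs
    rw [← norm_pow, one_sub_exp_mul, one_sub_exp_half_sq, norm_mul (2 * Complex.exp ((τ : ℂ) / 2)),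
      norm_mul (2 * Complex.exp ((τ : ℂ) / 2))]
    gcongr
    have e1 : Complex.cosh ((τ : ℂ) / 2) = ((Real.cosh (τ / 2) : ℝ) : ℂ) := by push_cast; rfl
    have e2 : Complex.cosh ((τ : ℂ) * (s - 1 / 2)) = ((Real.cosh (τ * (s - 1 / 2)) : ℝ) : ℂ) := by
      push_cast; rfl
    rw [e1, e2, ← Complex.ofReal_sub, ← Complex.ofReal_one, ← Complex.ofReal_sub, Complex.norm_real,
      Complex.norm_real]
    have : Real.cosh (τ * (s - 1 / 2)) ≤ Real.cosh (τ / 2) := by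
      rw [Real.cosh_le_cosh, abs_mul, div_eq_mul_inv τ 2, abs_mul τ 2⁻¹]
      refine mul_le_mul_of_nonneg_left ?_ (abs_nonneg _)
      rw [abs_le]; constructor <;> norm_num [abs_of_pos] <;> linarith [hs.1, hs.2]
    rw [Real.norm_of_nonneg (sub_nonneg.2 this),
      Real.norm_of_nonneg (sub_nonneg.2 (Real.one_le_cosh (τ / 2)))]
    linarith [Real.one_le_cosh (τ * (s - 1 / 2))]
  have hτ' : (τ : ℂ) ≠ 0 := by exact_mod_cast hτ.ne
  refine (norm_hypRev_sub_hypVal_le h0 h1 r hτ' hm).trans (le_of_eq ?_)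
  rw [← pow_mul]
  congr 1
  have hτα : τ * α < 0 := mul_neg_of_neg_of_pos hτ h0
  have hint : ∫ s in (0 : ℝ)..1, Real.exp ((τ : ℂ).re * α * s) = (Real.exp (τ * α) - 1) / (τ * α) := by
    rw [Complex.ofReal_re, intervalIntegral.integral_comp_mul_left (fun x => Real.exp x) hτα.ne]
    simp; field_simp
  have h3 : ‖1 - Complex.exp (τ * α)‖ = 1 - Real.exp (τ * α) := by
    rw [← Complex.ofReal_mul, ← Complex.ofReal_exp, ← Complex.ofReal_one, ← Complex.ofReal_sub,
      Complex.norm_real, Real.norm_of_nonneg]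
    have := Real.exp_le_one_iff.2 hτα.le
    linarith
  rw [hint, h3, Complex.norm_real, Real.norm_eq_abs, abs_of_neg hτ]
  have := hτ.ne
  field_simp
  ring

/-- The error of the Padé approximation to `w ^ α` on the unit circle. -/
lemma norm_remainder_le_of_unit {α : ℝ} (h0 : 0 < α) (h1 : α < 1) (r : ℕ) {θ : ℝ} (hθ : θ ≠ 0)
    (hθ' : |θ| ≤ Real.pi) :
    ‖Complex.exp (θ * Complex.I * α) * hypRev α r (Complex.exp (θ * Complex.I)) -
        hypVal α r (Complex.exp (θ * Complex.I))‖ ≤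
      upperFactor α r * ‖1 - Complex.exp (θ * Complex.I / 2)‖ ^ (2 * r) *
        (5 / 2 * ‖1 - Complex.exp (θ * Complex.I * α)‖) := by
  have hH := upperFactor_pos h0.le r
  have hm : ∀ s ∈ Set.Icc (0 : ℝ) 1,
      ‖(1 - Complex.exp (θ * Complex.I * s)) * (1 - Complex.exp (θ * Complex.I * (1 - s)))‖
      ≤ ‖1 - Complex.exp (θ * Complex.I / 2)‖ ^ 2 := by
    intro s hs
    rw [← norm_pow, one_sub_exp_mul, one_sub_exp_half_sq, norm_mul (2 * Complex.exp ((θ : ℂ) * Complex.I / 2)),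
      norm_mul (2 * Complex.exp ((θ : ℂ) * Complex.I / 2))]
    gcongr
    have e1 : Complex.cosh ((θ : ℂ) * Complex.I / 2) = ((Real.cos (θ / 2) : ℝ) : ℂ) := by
      rw [mul_div_right_comm, Complex.cosh_mul_I]; push_cast; rfl
    have e2 : Complex.cosh ((θ : ℂ) * Complex.I * (s - 1 / 2)) =
        ((Real.cos (θ * (s - 1 / 2)) : ℝ) : ℂ) := by
      rw [mul_right_comm, Complex.cosh_mul_I]; push_cast; rfl
    rw [e1, e2, ← Complex.ofReal_sub, ← Complex.ofReal_one, ← Complex.ofReal_sub, Complex.norm_real,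
      Complex.norm_real]
    have : Real.cos (θ / 2) ≤ Real.cos (θ * (s - 1 / 2)) := by
      rw [← Real.cos_abs (θ / 2), ← Real.cos_abs (θ * (s - 1 / 2))]
      refine Real.cos_le_cos_of_nonneg_of_le_pi (abs_nonneg _) ?_ ?_
      · rw [abs_div]; norm_num; linarith [Real.pi_pos]
      · rw [abs_mul, div_eq_mul_inv θ 2, abs_mul θ 2⁻¹]
        refine mul_le_mul_of_nonneg_left ?_ (abs_nonneg _)
        rw [abs_le]; constructor <;> norm_num [abs_of_pos] <;> linarith [hs.1, hs.2]
    rw [Real.norm_of_nonpos (sub_nonpos.2 this),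
      Real.norm_of_nonpos (sub_nonpos.2 (Real.cos_le_one (θ / 2)))]
    linarith [Real.cos_le_one (θ * (s - 1 / 2))]
  have hζ : (θ : ℂ) * Complex.I ≠ 0 := mul_ne_zero (by exact_mod_cast hθ) Complex.I_ne_zero
  refine (norm_hypRev_sub_hypVal_le h0 h1 r hζ hm).trans ?_
  rw [← pow_mul]
  refine mul_le_mul_of_nonneg_left ?_ (by positivity)
  have h3 : ‖1 - Complex.exp (θ * Complex.I * α)‖ = 2 * |Real.sin (θ * α / 2)| := by
    rw [norm_sub_rev, show (θ : ℂ) * Complex.I * α = Complex.I * ((θ * α : ℝ) : ℂ) by push_cast; ring,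
      Complex.norm_exp_I_mul_ofReal_sub_one]
    simp
  have habs : |θ * α / 2| = |θ| * α / 2 := by
    rw [abs_div, abs_mul, abs_of_pos h0]; norm_num
  -- Jordan's inequality gives α|θ| ≤ π |sin(θα/2)| = (π/2) ‖1 - e^{iθα}‖. The constant 5/2 is a
  -- convenient upper bound for π/2.
  have h4 := Real.mul_abs_le_abs_sin (x := θ * α / 2) (by
    rw [habs]; nlinarith [abs_nonneg θ])
  rw [habs] at h4
  rw [h3]
  simp only [Complex.mul_re, Complex.ofReal_re, Complex.I_re, Complex.ofReal_im, Complex.I_im,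
    mul_zero, sub_self, zero_mul, Real.exp_zero, intervalIntegral.integral_const, sub_zero,
    smul_eq_mul, mul_one, norm_mul, Complex.norm_I, Complex.norm_real, Real.norm_eq_abs]
  have hpi := Real.pi_lt_d2
  have hp := Real.pi_pos
  have h5 : 2 / Real.pi * (|θ| * α / 2) * Real.pi = |θ| * α := by field_simp
  have h6 := mul_le_mul_of_nonneg_right h4 hp.le
  rw [h5] at h6
  have h7 := abs_nonneg (Real.sin (θ * α / 2))
  nlinarith

/-! ### Independence of consecutive approximants -/

-- Factors of X - 1 are removed one at a time: the remaining quotient is still bounded by a multiple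
-- of 1 - w, so by continuity it vanishes at 1.
open Polynomial in
lemma X_sub_one_pow_dvd (m : ℕ) : ∀ (p : ℂ[X]) (B : ℝ),
    (∀ w ∈ Set.Ioo (1 / 2 : ℝ) 1, ‖p.eval (w : ℂ)‖ ≤ B * (1 - w) ^ m) → (X - C 1) ^ m ∣ p := by
  induction m with
  | zero => intro p B _; simp
  | succ m ih =>
    intro p B h
    have hB : 0 ≤ B := by
      have := (norm_nonneg _).trans (h (3 / 4) (by constructor <;> norm_num))
      by_contra hneg
      have h2 : (0 : ℝ) < (1 - 3 / 4) ^ (m + 1) := by positivity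
      nlinarith
    obtain ⟨q, rfl⟩ := ih p B fun w hw => (h w hw).trans (by
      have : (0 : ℝ) ≤ 1 - w := by linarith [hw.2]
      rw [pow_succ]
      refine mul_le_mul_of_nonneg_left ?_ hB
      exact mul_le_of_le_one_right (by positivity) (by linarith [hw.1]))
    rw [pow_succ]
    refine mul_dvd_mul_left _ (dvd_iff_isRoot.2 ?_)
    have hq : ∀ w ∈ Set.Ioo (1 / 2 : ℝ) 1, ‖q.eval (w : ℂ)‖ ≤ B * (1 - w) := by
      intro w hw
      have hpos : 0 < 1 - w := by linarith [hw.2]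
      have h1 := h w hw
      have h2 : ‖(w : ℂ) - 1‖ = 1 - w := by
        rw [norm_sub_rev, ← Complex.ofReal_one, ← Complex.ofReal_sub, Complex.norm_real,
          Real.norm_of_nonneg hpos.le]
      rw [eval_mul, eval_pow, eval_sub, eval_X, eval_C, norm_mul, norm_pow, h2, pow_succ] at h1
      have h3 : 0 < (1 - w) ^ m := by positivity
      rw [← mul_le_mul_iff_right₀ h3]
      linarith
    have hlim : Filter.Tendsto (fun w : ℝ => ‖q.eval (w : ℂ)‖) (nhdsWithin 1 (Set.Iio 1))
        (nhds ‖q.eval ((1 : ℝ) : ℂ)‖) :=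
      (Continuous.tendsto (by fun_prop) 1).mono_left nhdsWithin_le_nhds
    have hlim2 : Filter.Tendsto (fun w : ℝ => B * (1 - w)) (nhdsWithin 1 (Set.Iio 1))
        (nhds (B * (1 - 1))) :=
      (Continuous.tendsto (by fun_prop) 1).mono_left nhdsWithin_le_nhds
    have hle := le_of_tendsto_of_tendsto hlim hlim2 (by
      filter_upwards [Ioo_mem_nhdsLT (show (1 / 2 : ℝ) < 1 by norm_num)] with w hw
      exact hq w hw)
    have : ‖q.eval ((1 : ℝ) : ℂ)‖ = 0 := le_antisymm (by linarith) (norm_nonneg _)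
    simpa [IsRoot] using this

lemma norm_hypVal_le (α : ℝ) (r : ℕ) {w : ℂ} (hw : ‖w‖ ≤ 1) :
    ‖hypVal α r w‖ ≤ ∑ k ∈ range (r + 1), ‖hypCoeff (α : ℂ) r k‖ := by
  refine (norm_sum_le _ _).trans (sum_le_sum fun k _ => ?_)
  rw [norm_mul, norm_pow]
  exact mul_le_of_le_one_right (norm_nonneg _) (pow_le_one₀ (norm_nonneg _) hw)

/-- For w < 1 both 1 - √w and 1 - w^α are at most 1 - w, so the real estimate yields the order of
vanishing 2r + 1. -/
lemma norm_remainder_le_one_sub_pow {α : ℝ} (h0 : 0 < α) (h1 : α < 1) (r : ℕ) {w : ℝ}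
    (hw : w ∈ Set.Ioo (1 / 2 : ℝ) 1) :
    ‖Complex.exp (Real.log w * α) * hypRev α r w - hypVal α r w‖ ≤
      upperFactor α r * (1 - w) ^ (2 * r + 1) := by
  have hw0 : 0 < w := by linarith [hw.1]
  have hτ : Real.log w < 0 := Real.log_neg hw0 hw.2
  have h := norm_remainder_le_of_neg h0 h1 r hτ
  rw [← Complex.ofReal_exp, Real.exp_log hw0] at h
  refine h.trans ?_
  have key : ∀ c : ℝ, 0 ≤ c → c ≤ 1 → ‖1 - Complex.exp ((Real.log w * c : ℝ) : ℂ)‖ ≤ 1 - w := by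
    intro c hc hc1
    have e1 : Real.exp (Real.log w * c) ≤ 1 := Real.exp_le_one_iff.2 (by nlinarith)
    have e2 : w ≤ Real.exp (Real.log w * c) := by
      conv_lhs => rw [← Real.exp_log hw0]
      exact Real.exp_le_exp.2 (by nlinarith)
    rw [← Complex.ofReal_exp, ← Complex.ofReal_one, ← Complex.ofReal_sub, Complex.norm_real,
      Real.norm_of_nonneg (by linarith)]
    linarith
  have k1 := key (1 / 2) (by norm_num) (by norm_num)
  have k2 := key α h0.le h1.le
  push_cast at k1 k2
  rw [mul_one_div] at k1
  have hH := upperFactor_pos h0.le r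
  have : (0 : ℝ) ≤ 1 - w := by linarith [hw.2]
  rw [pow_succ, ← mul_assoc]
  gcongr

/-- The determinant of two consecutive Padé approximants vanishes only at `1`. -/
lemma hypVal_mul_hypRev_sub_ne_zero {α : ℝ} (h0 : 0 < α) (h1 : α < 1) (r : ℕ) {w : ℂ}
    (hw : w ≠ 1) :
    hypVal α r w * hypRev α (r + 1) w - hypVal α (r + 1) w * hypRev α r w ≠ 0 := by
  open Polynomial in
  let p : ℕ → ℂ[X] := fun r => ∑ k ∈ range (r + 1), C (hypCoeff (α : ℂ) r k) * X ^ k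
  open Polynomial in
  let q : ℕ → ℂ[X] := fun r => ∑ k ∈ range (r + 1), C (hypCoeff (α : ℂ) r k) * X ^ (r - k)
  have hp : ∀ r w, (p r).eval w = hypVal α r w := fun r w => by
    simp [p, hypVal, Polynomial.eval_finsetSum]
  have hq : ∀ r w, (q r).eval w = hypRev α r w := fun r w => by
    simp [q, hypRev, Polynomial.eval_finsetSum]
  have hpd : ∀ r, (p r).natDegree ≤ r := fun r =>
    Polynomial.natDegree_sum_le_of_forall_le _ _ fun k hk =>
      (Polynomial.natDegree_C_mul_X_pow_le _ _).trans (by have := mem_range.1 hk; omega)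
  have hqd : ∀ r, (q r).natDegree ≤ r := fun r =>
    Polynomial.natDegree_sum_le_of_forall_le _ _ fun k hk =>
      (Polynomial.natDegree_C_mul_X_pow_le _ _).trans (by omega)
  set Δ := p r * q (r + 1) - p (r + 1) * q r with hΔ
  have hdeg : Δ.natDegree ≤ 2 * r + 1 := by
    refine (Polynomial.natDegree_sub_le _ _).trans (max_le ?_ ?_)
    · exact Polynomial.natDegree_mul_le.trans (by linarith [hpd r, hqd (r + 1)])
    · exact Polynomial.natDegree_mul_le.trans (by linarith [hpd (r + 1), hqd r])
  have hev : ∀ w, Δ.eval w =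
      hypVal α r w * hypRev α (r + 1) w - hypVal α (r + 1) w * hypRev α r w := fun w => by
    simp [hΔ, hp, hq]
  have hdvd : (Polynomial.X - Polynomial.C (1 : ℂ)) ^ (2 * r + 1) ∣ Δ := by
    refine X_sub_one_pow_dvd (2 * r + 1) Δ
      (2 * ((∑ k ∈ range (r + 1), ‖hypCoeff (α : ℂ) r k‖) * upperFactor α (r + 1) +
        (∑ k ∈ range (r + 2), ‖hypCoeff (α : ℂ) (r + 1) k‖) * upperFactor α r)) fun x hx => ?_
    have hx0 : 0 < x := by linarith [hx.1]
    have hx1 : 0 ≤ 1 - x := by linarith [hx.2]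
    have hxn : ‖(x : ℂ)‖ ≤ 1 := by
      rw [Complex.norm_real, Real.norm_of_nonneg hx0.le]; exact hx.2.le
    set ω := Complex.exp (Real.log x * α) with hω
    have hωn : 1 / 2 ≤ ‖ω‖ := by
      rw [hω, Complex.norm_exp]
      have : ((Real.log x : ℂ) * α).re = Real.log x * α := by simp
      rw [this]
      have h2 : x ≤ Real.exp (Real.log x * α) := by
        conv_lhs => rw [← Real.exp_log hx0]
        have := Real.log_neg hx0 hx.2
        exact Real.exp_le_exp.2 (by nlinarith)
      linarith [hx.1]
    -- Eliminating the products X_r X_{r+1} writes the determinant through the two remainders, each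
    -- of order at least 2r + 1 at 1.
    have e : ω * Δ.eval (x : ℂ) =
        hypVal α r x * (ω * hypRev α (r + 1) x - hypVal α (r + 1) x) -
        hypVal α (r + 1) x * (ω * hypRev α r x - hypVal α r x) := by
      rw [hev]; ring
    have b1 := norm_remainder_le_one_sub_pow h0 h1 r hx
    have b2 : ‖ω * hypRev α (r + 1) x - hypVal α (r + 1) x‖ ≤
        upperFactor α (r + 1) * (1 - x) ^ (2 * r + 1) := by
      refine (norm_remainder_le_one_sub_pow h0 h1 (r + 1) hx).trans ?_
      have := upperFactor_pos h0.le (r + 1)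
      refine mul_le_mul_of_nonneg_left ?_ this.le
      exact pow_le_pow_of_le_one hx1 (by linarith) (by omega)
    have b3 := norm_hypVal_le α r hxn
    have b4 := norm_hypVal_le α (r + 1) hxn
    have h5 : ‖ω‖ * ‖Δ.eval (x : ℂ)‖ ≤
        (∑ k ∈ range (r + 1), ‖hypCoeff (α : ℂ) r k‖) * (upperFactor α (r + 1) * (1 - x) ^ (2 * r + 1)) +
        (∑ k ∈ range (r + 2), ‖hypCoeff (α : ℂ) (r + 1) k‖) *
          (upperFactor α r * (1 - x) ^ (2 * r + 1)) := by
      rw [← norm_mul, e]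
      refine (norm_sub_le _ _).trans ?_
      rw [norm_mul, norm_mul]
      gcongr
    nlinarith [norm_nonneg (Δ.eval (x : ℂ))]
  obtain ⟨c, hc⟩ := hdvd
  -- At 0 the determinant is the difference of the leading coefficients of X_{r+1} and X_r. These
  -- are ∏ (m+1+α)/(m+1-α), strictly increasing in r.
  have hΔ0 : Δ.eval 0 ≠ 0 := by
    have v0 : ∀ r, hypVal α r 0 = 1 := fun r => by
      rw [hypVal, sum_range_succ']
      simp [hypCoeff]
    have v1 : ∀ r, hypRev α r 0 = ((hypCoeff α r r : ℝ) : ℂ) := fun r => by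
      rw [hypRev, sum_range_succ, sum_eq_zero, zero_add, Nat.sub_self, pow_zero, mul_one,
        ofReal_hypCoeff]
      intro k hk
      rw [zero_pow (by have := mem_range.1 hk; omega), mul_zero]
    rw [hev, v0, v0, v1, v1, one_mul, one_mul, ← Complex.ofReal_sub]
    have v2 : ∀ r, hypCoeff α r r = ∏ m ∈ range r, ((m + 1 + α) / (m + 1 - α)) := by
      intro r
      have f1 : hypCoeff α r r = (∏ j ∈ range r, ((r : ℝ) - j)) * (∏ j ∈ range r, ((r : ℝ) + α - j)) /
          ((∏ j ∈ range r, ((j : ℝ) + 1)) * ∏ j ∈ range r, ((j : ℝ) + 1 - α)) := by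
        rw [hypCoeff, prod_div_distrib, prod_mul_distrib, prod_mul_distrib]
      have f2 : ∏ j ∈ range r, ((r : ℝ) - j) = ∏ j ∈ range r, ((j : ℝ) + 1) := by
        rw [← prod_range_reflect]
        refine prod_congr rfl fun j hj => ?_
        have hj := mem_range.1 hj
        rw [show r - 1 - j = r - (j + 1) by omega, Nat.cast_sub (by omega)]
        push_cast; ring
      have f3 : ∏ j ∈ range r, ((r : ℝ) + α - j) = ∏ j ∈ range r, ((j : ℝ) + 1 + α) := by
        rw [← prod_range_reflect]
        refine prod_congr rfl fun j hj => ?_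
        have hj := mem_range.1 hj
        rw [show r - 1 - j = r - (j + 1) by omega, Nat.cast_sub (by omega)]
        push_cast; ring
      have f4 : ∏ j ∈ range r, ((j : ℝ) + 1) ≠ 0 := prod_ne_zero_iff.2 fun j _ => by positivity
      rw [f1, f2, f3, mul_div_mul_left _ _ f4, prod_div_distrib]
    have hpos : 0 < hypCoeff α r r := hypCoeff_pos h0.le h1 le_rfl
    have : hypCoeff α r r < hypCoeff α (r + 1) (r + 1) := by
      rw [v2 (r + 1), prod_range_succ, ← v2 r]
      refine lt_mul_of_one_lt_right hpos ?_
      have : (0 : ℝ) ≤ r := r.cast_nonneg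
      rw [one_lt_div (by linarith)]; linarith
    exact_mod_cast (sub_pos.2 this).ne'
  have hc0 : c ≠ 0 := by rintro rfl; simp [hc] at hΔ0
  have hcd : c.natDegree = 0 := by
    have hm : ((Polynomial.X - Polynomial.C (1 : ℂ)) ^ (2 * r + 1)).Monic :=
      (Polynomial.monic_X_sub_C 1).pow _
    rw [hc, hm.natDegree_mul' hc0, Polynomial.natDegree_pow, Polynomial.natDegree_X_sub_C] at hdeg
    omega
  rw [← hev, hc, Polynomial.eq_C_of_natDegree_eq_zero hcd]
  rw [Polynomial.eq_C_of_natDegree_eq_zero hcd] at hc0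
  simp only [Polynomial.eval_mul, Polynomial.eval_pow, Polynomial.eval_sub, Polynomial.eval_X,
    Polynomial.eval_C]
  refine mul_ne_zero (pow_ne_zero _ (sub_ne_zero.2 hw)) ?_
  simpa using hc0

/-! ### The estimates at an admissible argument -/

/-- On the unit circle 1/y² is the conjugate of y², so Y_r(y²) is a unimodular multiple of X_r at
the conjugate point. -/
lemma norm_hypRev_le_of_unit {α : ℝ} (h0 : 0 ≤ α) (h1 : α ≤ 1 / 2) (r : ℕ) {y : ℂ}
    (hy : ‖y‖ = 1) (hre : 0 ≤ y.re) :
    ‖hypRev α r (y ^ 2)‖ ≤ 2 * lowerFactor α r * ‖1 + y‖ ^ (2 * r) := by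
  have hn : Complex.normSq y = 1 := by rw [Complex.normSq_eq_norm_sq, hy]; norm_num
  have hc : y * (starRingEnd ℂ) y = 1 := by rw [Complex.mul_conj, hn]; simp
  have h := norm_sum_hypCoeff_le h0 h1 r (y := (starRingEnd ℂ) y) (by simpa using hy) (by simpa using hre)
  have h2 : ‖1 + (starRingEnd ℂ) y‖ = ‖1 + y‖ := by
    rw [← RCLike.norm_conj (1 + y)]; simp
  have h3 : hypRev α r (y ^ 2) = (y ^ 2) ^ r *
      ∑ k ∈ range (r + 1), hypCoeff (α : ℂ) r k * ((starRingEnd ℂ) y ^ 2) ^ k := by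
    rw [hypRev, mul_sum]
    refine sum_congr rfl fun k hk => ?_
    have hk : k ≤ r := by simpa [Nat.lt_succ_iff] using hk
    have : (y ^ 2) ^ r * ((starRingEnd ℂ) y ^ 2) ^ k = (y ^ 2) ^ (r - k) := by
      obtain ⟨m, rfl⟩ := Nat.exists_eq_add_of_le hk
      rw [Nat.add_sub_cancel_left, pow_add, mul_right_comm, ← mul_pow, ← mul_pow, hc]
      simp
    rw [← this]; ring
  rw [h3, norm_mul, norm_pow, norm_pow, hy, one_pow, one_pow, one_mul, ← h2]
  exact h

lemma nthRoot_eq_exp (n : ℕ) {w : ℂ} (hw : w ≠ 0) :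
    nthRoot n w = Complex.exp (Complex.log w * ((1 / n : ℝ) : ℂ)) := by
  rw [nthRoot, Complex.cpow_def_of_ne_zero hw]; push_cast; rfl

lemma csqrt_eq_exp {w : ℂ} (hw : w ≠ 0) : Complex.sqrt w = Complex.exp (Complex.log w / 2) := by
  rw [Complex.sqrt, Complex.cpow_def_of_ne_zero hw]; rfl

lemma csqrt_sq (w : ℂ) : Complex.sqrt w ^ 2 = w := by
  rw [Complex.sqrt, ← Complex.cpow_nat_mul]; norm_num

lemma csqrt_re_nonneg (w : ℂ) : 0 ≤ (Complex.sqrt w).re := by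
  rw [Complex.sqrt, Complex.cpow_inv_two_re]; positivity


/-- All the estimates for the hypergeometric polynomials at an admissible argument `w`. -/
lemma hyp_estimates {n : ℕ} (hn : 3 ≤ n) {w : ℂ} (hw1 : w ≠ 1)
    (hw : (∃ x : ℝ, 0 < x ∧ x < 1 ∧ 1 / 8 ≤ √x ∧ w = x) ∨ ‖w‖ = 1) (r : ℕ) :
    ‖nthRoot n w * hypRev (1 / n) r w - hypVal (1 / n) r w‖ ≤
        5 / 2 * upperFactor (1 / n) r * ‖1 - nthRoot n w‖ * (‖1 - Complex.sqrt w‖ ^ 2) ^ r ∧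
      ‖hypVal (1 / n) r w‖ ≤ 2 * lowerFactor (1 / n) r * (‖1 + Complex.sqrt w‖ ^ 2) ^ r ∧
      ‖hypRev (1 / n) r w‖ ≤ 2 * lowerFactor (1 / n) r * (‖1 + Complex.sqrt w‖ ^ 2) ^ r := by
  have hn' : (3 : ℝ) ≤ n := by exact_mod_cast hn
  have h0 : (0 : ℝ) < 1 / n := by positivity
  have h13 : (1 : ℝ) / n ≤ 1 / 3 := one_div_le_one_div_of_le (by norm_num) hn'
  have h1 : (1 : ℝ) / n < 1 := by linarith
  have hH := upperFactor_pos h0.le r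
  simp_rw [← pow_mul]
  rcases hw with ⟨x, hx0, hx1, hx8, rfl⟩ | hw
  · have hxc : (x : ℂ) ≠ 0 := by exact_mod_cast hx0.ne'
    have hs : Complex.sqrt x = ((√x : ℝ) : ℂ) := by
      have := Complex.sqrt_of_nonneg (a := (x : ℂ)) (by exact_mod_cast hx0.le)
      simpa using this
    have hs0 : 0 ≤ √x := Real.sqrt_nonneg x
    have hs1 : √x ≤ 1 := by
      rw [Real.sqrt_le_left zero_le_one]; linarith
    have hsq : √x ^ 2 = x := Real.sq_sqrt hx0.le
    have hplus : ‖1 + Complex.sqrt x‖ = 1 + √x := by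
      rw [hs, ← Complex.ofReal_one, ← Complex.ofReal_add, Complex.norm_real,
        Real.norm_of_nonneg (by linarith)]
    refine ⟨?_, ?_, ?_⟩
    · have := norm_remainder_le_of_neg h0 h1 r (Real.log_neg hx0 hx1)
      rw [Complex.ofReal_log hx0.le, Complex.exp_log hxc, ← nthRoot_eq_exp n hxc,
        ← csqrt_eq_exp hxc] at this
      refine this.trans ?_
      have h5 : 0 ≤ upperFactor (1 / n) r * ‖1 - Complex.sqrt x‖ ^ (2 * r) * ‖1 - nthRoot n x‖ := by
        positivity
      linarith
    · have := sum_hypCoeff_le h0.le h1 r hs0 hs1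
      rw [hsq] at this
      have he : hypVal (1 / n) r x =
          ((∑ k ∈ range (r + 1), hypCoeff (1 / n : ℝ) r k * x ^ k : ℝ) : ℂ) := by
        rw [hypVal]; push_cast [ofReal_hypCoeff]; rfl
      rw [he, Complex.norm_real, hplus, Real.norm_of_nonneg]
      · exact this
      · exact sum_nonneg fun k hk => mul_nonneg
          (hypCoeff_pos h0.le h1 (by simpa [Nat.lt_succ_iff] using hk)).le (by positivity)
    · have := sum_hypCoeff_rev_le h0.le h13 r hx8
      rw [hsq] at this
      have he : hypRev (1 / n) r x =
          ((∑ k ∈ range (r + 1), hypCoeff (1 / n : ℝ) r k * x ^ (r - k) : ℝ) : ℂ) := by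
        rw [hypRev]; push_cast [ofReal_hypCoeff]; rfl
      rw [he, Complex.norm_real, hplus, Real.norm_of_nonneg]
      · exact this
      · exact sum_nonneg fun k hk => mul_nonneg
          (hypCoeff_pos h0.le h1 (by simpa [Nat.lt_succ_iff] using hk)).le (by positivity)
  · have hw0 : w ≠ 0 := by rintro rfl; simp at hw
    have hy : ‖Complex.sqrt w‖ = 1 := by
      have h2 : ‖Complex.sqrt w‖ ^ 2 = 1 := by rw [← norm_pow, csqrt_sq, hw]
      nlinarith [norm_nonneg (Complex.sqrt w)]
    have hre := csqrt_re_nonneg w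
    have hlog : Complex.log w = (Complex.arg w : ℂ) * Complex.I := by
      rw [Complex.log, hw]; simp
    refine ⟨?_, ?_, ?_⟩
    · have harg : Complex.arg w ≠ 0 := by
        intro h
        rw [h] at hlog
        apply hw1
        rw [← Complex.exp_log hw0, hlog]; simp
      have := norm_remainder_le_of_unit h0 h1 r harg (Complex.abs_arg_le_pi w)
      rw [← hlog, Complex.exp_log hw0, ← nthRoot_eq_exp n hw0, ← csqrt_eq_exp hw0] at this
      refine this.trans (le_of_eq ?_)
      ring
    · have := norm_sum_hypCoeff_le h0.le (by linarith) r hy hre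
      rw [csqrt_sq] at this
      exact this
    · have := norm_hypRev_le_of_unit h0.le (by linarith) r hy hre
      rw [csqrt_sq] at this
      exact this

/-! ### Denominators and numerators of the coefficients -/

lemma hypCoeff_eq_zero {F : Type*} [Field F] (α : F) {r k : ℕ} (hk : r < k) :
    hypCoeff α r k = 0 :=
  prod_eq_zero (mem_range.2 hk) (by simp)

lemma ordinaryHypergeometricCoefficient_eq (α : ℚ) (r k : ℕ) :
    ordinaryHypergeometricCoefficient (-(r : ℚ)) (-(r : ℚ) - α) (1 - α) k = hypCoeff α r k := by
  induction k with
  | zero => simp [hypCoeff, ordinaryHypergeometricCoefficient]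
  | succ k ih =>
    rw [hypCoeff, prod_range_succ, ← hypCoeff, ← ih]
    simp only [ordinaryHypergeometricCoefficient, ascPochhammer_succ_eval, Nat.factorial_succ,
      Nat.cast_mul, mul_inv, div_eq_mul_inv]
    push_cast
    rw [show (1 : ℚ) - α + k = k + 1 - α by ring]
    ring

lemma coeff_hypPoly (n r k : ℕ) : (hypPoly n r).coeff k = hypCoeff (1 / n : ℚ) r k := by
  rw [hypPoly, Polynomial.finsetSum_coeff]
  simp only [Polynomial.coeff_monomial, ordinaryHypergeometricCoefficient_eq]
  rw [sum_ite_eq' (range (r + 1)) k]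
  split_ifs with h
  · rfl
  · rw [hypCoeff_eq_zero]; simpa using h

lemma natDegree_hypPoly_le (n r : ℕ) : (hypPoly n r).natDegree ≤ r := by
  rw [Polynomial.natDegree_le_iff_coeff_eq_zero]
  intro k hk
  rw [coeff_hypPoly, hypCoeff_eq_zero _ hk]

lemma aeval_hypPoly (n r : ℕ) (w : ℂ) : Polynomial.aeval w (hypPoly n r) = hypVal (1 / n) r w := by
  rw [Polynomial.aeval_eq_sum_range' (Nat.lt_succ_of_le (natDegree_hypPoly_le n r)), hypVal]
  refine sum_congr rfl fun k _ => ?_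
  rw [coeff_hypPoly, Algebra.smul_def, map_hypCoeff]
  simp

lemma denom_spec (n r : ℕ) :
    0 < denom n r ∧ ∀ k : ℕ, ∃ z : ℤ, (denom n r : ℚ) * (hypPoly n r).coeff k = z := by
  refine Nat.sInf_mem (s := {D : ℕ | 0 < D ∧ ∀ k : ℕ, ∃ z : ℤ, (D : ℚ) * (hypPoly n r).coeff k = z})
    ⟨∏ k ∈ range (r + 1), ((hypPoly n r).coeff k).den, prod_pos fun k _ => Rat.den_pos _, fun k => ?_⟩
  by_cases hk : k ∈ range (r + 1)
  · obtain ⟨m, hm⟩ := dvd_prod_of_mem (fun k => ((hypPoly n r).coeff k).den) hk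
    refine ⟨m * ((hypPoly n r).coeff k).num, ?_⟩
    rw [hm]
    push_cast
    rw [mul_comm (((hypPoly n r).coeff k).den : ℚ), mul_assoc, Rat.den_mul_eq_num]
  · refine ⟨0, ?_⟩
    rw [coeff_hypPoly, hypCoeff_eq_zero _ (by simpa using hk)]; simp

/-- The polynomial `X_{n,r}(1 - d x)`. -/
noncomputable def shiftPoly (d n r : ℕ) : Polynomial ℚ :=
  (hypPoly n r).comp (1 - Polynomial.C (d : ℚ) * Polynomial.X)

lemma natDegree_shiftPoly_le (d n r : ℕ) : (shiftPoly d n r).natDegree ≤ r := by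
  refine Polynomial.natDegree_comp_le.trans ?_
  calc _ ≤ r * 1 := Nat.mul_le_mul (natDegree_hypPoly_le n r) (by compute_degree)
    _ = r := mul_one r

/-- The polynomial D_{n,r} X_{n,r} lifts to ℤ[x], and substituting 1 - dx preserves integrality. -/
lemma denom_mul_coeff_shiftPoly (d n r k : ℕ) :
    ∃ z : ℤ, (denom n r : ℚ) * (shiftPoly d n r).coeff k = z := by
  have h : ∃ P : Polynomial ℤ, P.map (Int.castRingHom ℚ) =
      Polynomial.C (denom n r : ℚ) * hypPoly n r := by
    rw [← Polynomial.mem_lifts, Polynomial.lifts_iff_coeff_lifts]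
    intro k
    obtain ⟨z, hz⟩ := (denom_spec n r).2 k
    exact ⟨z, by rw [Polynomial.coeff_C_mul, hz]; simp⟩
  obtain ⟨P, hP⟩ := h
  refine ⟨(P.comp (1 - Polynomial.C (d : ℤ) * Polynomial.X)).coeff k, ?_⟩
  have h2 : (P.comp (1 - Polynomial.C (d : ℤ) * Polynomial.X)).map (Int.castRingHom ℚ) =
      Polynomial.C (denom n r : ℚ) * shiftPoly d n r := by
    rw [Polynomial.map_comp, hP, shiftPoly, Polynomial.mul_comp, Polynomial.C_comp]
    simp
  rw [← Polynomial.coeff_C_mul, ← h2, Polynomial.coeff_map]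
  simp

lemma coeff_zero_shiftPoly (d n r : ℕ) :
    (((shiftPoly d n r).coeff 0 : ℚ) : ℝ) = ∑ k ∈ range (r + 1), hypCoeff (1 / n : ℝ) r k := by
  have : (shiftPoly d n r).coeff 0 = ∑ k ∈ range (r + 1), hypCoeff (1 / n : ℚ) r k := by
    rw [Polynomial.coeff_zero_eq_eval_zero, shiftPoly, Polynomial.eval_comp]
    simp only [Polynomial.eval_sub, Polynomial.eval_one, Polynomial.eval_mul, Polynomial.eval_C,
      Polynomial.eval_X, mul_zero, sub_zero]
    rw [Polynomial.eval_eq_sum_range' (Nat.lt_succ_of_le (natDegree_hypPoly_le n r))]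
    refine sum_congr rfl fun k _ => ?_
    rw [coeff_hypPoly]; simp
  rw [this]
  push_cast
  refine sum_congr rfl fun k _ => ?_
  have := map_hypCoeff (Rat.castHom ℝ) (1 / n : ℚ) r k
  simpa using this

lemma coeff_zero_shiftPoly_pos {n : ℕ} (hn : 2 ≤ n) (d r : ℕ) : 0 < (shiftPoly d n r).coeff 0 := by
  have hn' : (2 : ℝ) ≤ n := by exact_mod_cast hn
  have h0 : (0 : ℝ) < 1 / n := by positivity
  have h13 : (1 : ℝ) / n ≤ 1 / 2 := one_div_le_one_div_of_le (by norm_num) hn'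
  have : (0 : ℝ) < ((shiftPoly d n r).coeff 0 : ℚ) := by
    rw [coeff_zero_shiftPoly]
    exact sum_pos (fun k hk => hypCoeff_pos h0.le (by linarith)
      (by simpa [Nat.lt_succ_iff] using hk)) ⟨0, by simp⟩
  exact_mod_cast this

lemma numGcd_pos {n : ℕ} (hn : 2 ≤ n) (d r : ℕ) : 0 < numGcd d n r := by
  rw [Nat.pos_iff_ne_zero, numGcd, Ne, Finset.gcd_eq_zero_iff]
  intro h
  have := h 0 (by simp)
  rw [Int.natAbs_eq_zero, Rat.num_eq_zero] at this
  exact (coeff_zero_shiftPoly_pos hn d r).ne' this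

/-- For a fraction in lowest terms, the common divisor divides its numerator and, separately, its
denominator divides D_{n,r}. -/
lemma denom_div_numGcd_mul_coeff {n : ℕ} (hn : 2 ≤ n) (d r k : ℕ) :
    ∃ z : ℤ, ((denom n r : ℚ) / numGcd d n r) * (shiftPoly d n r).coeff k = z := by
  by_cases hk : k ∈ range (r + 1)
  · obtain ⟨m, hm⟩ := denom_mul_coeff_shiftPoly d n r k
    set q := (shiftPoly d n r).coeff k with hq
    have hN : (numGcd d n r : ℤ) ∣ q.num :=
      Int.natCast_dvd.2 (Finset.gcd_dvd (f := fun k => ((shiftPoly d n r).coeff k).num.natAbs) hk)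
    obtain ⟨a, ha⟩ := hN
    have hb : (q.den : ℤ) ∣ denom n r := by
      have h2 : (denom n r : ℤ) * q.num = m * q.den := by
        have : (denom n r : ℚ) * q.num = m * q.den := by
          rw [← hm, mul_assoc, Rat.mul_den_eq_num]
        exact_mod_cast this
      have hcop : IsCoprime (q.den : ℤ) q.num := by
        rw [Int.isCoprime_iff_gcd_eq_one, Int.gcd_comm]
        exact q.reduced
      exact hcop.dvd_of_dvd_mul_right (Dvd.intro_left m h2.symm)
    obtain ⟨b, hb⟩ := hb
    refine ⟨b * a, ?_⟩
    have hN0 : (numGcd d n r : ℚ) ≠ 0 := by exact_mod_cast (numGcd_pos hn d r).ne'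
    have hden : (q.den : ℚ) ≠ 0 := by exact_mod_cast q.den_nz
    have e1 : (q.num : ℚ) = numGcd d n r * a := by exact_mod_cast ha
    have e2 : (denom n r : ℚ) = q.den * b := by exact_mod_cast hb
    rw [e2]
    have e3 : q = numGcd d n r * a / q.den := by rw [← e1, Rat.num_div_den]
    calc (q.den : ℚ) * b / numGcd d n r * q
        = q.den * b / numGcd d n r * (numGcd d n r * a / q.den) := by rw [← e3]
      _ = _ := by push_cast; field_simp
  · refine ⟨0, ?_⟩
    rw [Polynomial.coeff_eq_zero_of_natDegree_lt
      ((natDegree_shiftPoly_le d n r).trans_lt (by simpa using hk))]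
    simp

/-- Scaled values of the hypergeometric polynomial are algebraic integers. -/
lemma isIntegral_hypVal {n : ℕ} (hn : 2 ≤ n) (d r : ℕ) {u f g : ℂ} (hu : u ≠ 0)
    (hug : IsIntegral ℤ (u / g)) (hfg : IsIntegral ℤ (f / g)) :
    IsIntegral ℤ (((denom n r : ℂ) / numGcd d n r) *
      (u ^ r * hypVal (1 / n) r ((u - d * f) / u)) / g ^ r) := by
  have h1 : u ^ r * hypVal (1 / n) r ((u - d * f) / u) =
      ∑ k ∈ range (r + 1), ((shiftPoly d n r).coeff k : ℂ) * (f ^ k * u ^ (r - k)) := by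
    have : Polynomial.aeval (f / u) (shiftPoly d n r) = hypVal (1 / n) r ((u - d * f) / u) := by
      rw [shiftPoly, Polynomial.aeval_comp, ← aeval_hypPoly]
      congr 1
      simp
      field_simp
    rw [← this, Polynomial.aeval_eq_sum_range' (Nat.lt_succ_of_le (natDegree_shiftPoly_le d n r)),
      mul_sum]
    refine sum_congr rfl fun k hk => ?_
    have hk : k ≤ r := by simpa [Nat.lt_succ_iff] using hk
    obtain ⟨m, rfl⟩ := Nat.exists_eq_add_of_le hk
    rw [Nat.add_sub_cancel_left, Algebra.smul_def, eq_ratCast, div_pow, pow_add]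
    field_simp
  have h2 : ((denom n r : ℂ) / numGcd d n r) *
      (u ^ r * hypVal (1 / n) r ((u - d * f) / u)) / g ^ r =
      ∑ k ∈ range (r + 1), (((denom n r : ℂ) / numGcd d n r) * (shiftPoly d n r).coeff k) *
        ((f / g) ^ k * (u / g) ^ (r - k)) := by
    rw [h1, mul_sum, sum_div]
    refine sum_congr rfl fun k hk => ?_
    have hk : k ≤ r := by simpa [Nat.lt_succ_iff] using hk
    obtain ⟨m, rfl⟩ := Nat.exists_eq_add_of_le hk
    rw [Nat.add_sub_cancel_left, div_pow, div_pow, pow_add]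
    ring
  rw [h2]
  refine IsIntegral.sum _ fun k _ => ?_
  refine IsIntegral.mul ?_ ((hfg.pow _).mul (hug.pow _))
  obtain ⟨z, hz⟩ := denom_div_numGcd_mul_coeff hn d r k
  have : ((denom n r : ℂ) / numGcd d n r) * (shiftPoly d n r).coeff k = z := by
    have := congrArg (fun q : ℚ => (q : ℂ)) hz
    push_cast at this
    exact this
  rw [this]
  exact isIntegral_algebraMap (R := ℤ) (A := ℂ) (x := z)

/-! ### Consequences of admissibility -/

lemma Gamma_lower (α : ℝ) (h1 : α < 1) (r : ℕ) :
    Real.Gamma (1 - α) * r.factorial / Real.Gamma (r + 1 - α) = lowerFactor α r := by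
  have hpos := Real.Gamma_pos_of_pos (show 0 < 1 - α by linarith)
  induction r with
  | zero => simp [lowerFactor, hpos.ne']
  | succ r ih =>
    have hr : (0 : ℝ) ≤ r := r.cast_nonneg
    have h2 : (r : ℝ) + 1 - α ≠ 0 := by linarith
    have h3 := (Real.Gamma_pos_of_pos (show 0 < (r : ℝ) + 1 - α by linarith)).ne'
    rw [lowerFactor, prod_range_succ, ← lowerFactor, ← ih]
    rw [show ((r + 1 : ℕ) : ℝ) + 1 - α = (r + 1 - α) + 1 by push_cast; ring, Real.Gamma_add_one h2,
      Nat.factorial_succ]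
    push_cast
    field_simp

lemma Gamma_upper {n : ℕ} (hn : 1 ≤ n) (r : ℕ) :
    n * Real.Gamma (r + 1 + 1 / n) / (Real.Gamma (1 / n) * r.factorial) =
      upperFactor (1 / n) r := by
  have hn' : (0 : ℝ) < n := by exact_mod_cast hn
  have h0 : (0 : ℝ) < 1 / n := by positivity
  have hpos := Real.Gamma_pos_of_pos h0
  induction r with
  | zero =>
    simp only [Nat.cast_zero, zero_add, Nat.factorial_zero, Nat.cast_one, mul_one, upperFactor,
      range_zero, prod_empty]
    rw [add_comm, Real.Gamma_add_one h0.ne']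
    field_simp
  | succ r ih =>
    have h2 : (r : ℝ) + 1 + 1 / n ≠ 0 := by positivity
    rw [upperFactor, prod_range_succ, ← upperFactor, ← ih]
    rw [show ((r + 1 : ℕ) : ℝ) + 1 + 1 / n = (r + 1 + 1 / n) + 1 by push_cast; ring,
      Real.Gamma_add_one h2, Nat.factorial_succ]
    push_cast
    field_simp

lemma calN_pos (d n : ℕ) : 0 < calN d n :=
  prod_pos fun p hp => Real.rpow_pos_of_pos
    (by exact_mod_cast (Nat.prime_of_mem_primeFactors hp).pos) _

lemma Admissible.bounds {d n : ℕ} {C D : ℝ} (hn : 2 ≤ n) (h : Admissible d n C D) (r : ℕ) :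
    lowerFactor (1 / n) r * ((denom n r : ℝ) / numGcd d n r) < C * (D / calN d n) ^ r ∧
      upperFactor (1 / n) r * ((denom n r : ℝ) / numGcd d n r) < C * (D / calN d n) ^ r := by
  have hn' : (2 : ℝ) ≤ n := by exact_mod_cast hn
  have h13 : (1 : ℝ) / n ≤ 1 / 2 := one_div_le_one_div_of_le (by norm_num) hn'
  have h1 := h.2.2 r
  rw [Gamma_lower _ (by linarith), Gamma_upper (by omega)] at h1
  have hx : 0 ≤ (denom n r : ℝ) / numGcd d n r := by positivity
  refine ⟨lt_of_le_of_lt (mul_le_mul_of_nonneg_right ?_ hx) h1,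
    lt_of_le_of_lt (mul_le_mul_of_nonneg_right ?_ hx) h1⟩
  · exact (le_max_left _ _).trans (le_max_right _ _)
  · exact (le_max_right _ _).trans (le_max_right _ _)

/-- X_{n,r}(1) D_{n,r}/N_{d,n,r} is a positive integer, while X_{n,r}(1) is at most 2 · 4^r times
the Gamma factor. Hence 1 < 2C (4D/𝒩)^r for all r, which is impossible if 4D < 𝒩. -/
lemma Admissible.calN_le {d n : ℕ} {C D : ℝ} (hn : 2 ≤ n) (h : Admissible d n C D) :
    calN d n ≤ 4 * D := by
  have hn' : (2 : ℝ) ≤ n := by exact_mod_cast hn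
  have h0 : (0 : ℝ) < 1 / n := by positivity
  have h13 : (1 : ℝ) / n ≤ 1 / 2 := one_div_le_one_div_of_le (by norm_num) hn'
  have hN := calN_pos d n
  have hD := h.2.1
  have key : ∀ r : ℕ, 1 < 2 * C * (4 * (D / calN d n)) ^ r := by
    intro r
    set ρ : ℝ := (denom n r : ℝ) / numGcd d n r with hρ
    have hρ0 : 0 < ρ := by
      have := (denom_spec n r).1
      have := numGcd_pos hn d r
      positivity
    obtain ⟨z, hz⟩ := denom_div_numGcd_mul_coeff hn d r 0
    have hz' : ρ * ∑ k ∈ range (r + 1), hypCoeff (1 / n : ℝ) r k = z := by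
      rw [← coeff_zero_shiftPoly d n r]
      have := congrArg (fun q : ℚ => (q : ℝ)) hz
      push_cast at this
      exact this
    have hs : 0 < ∑ k ∈ range (r + 1), hypCoeff (1 / n : ℝ) r k :=
      sum_pos (fun k hk => hypCoeff_pos h0.le (by linarith)
        (by simpa [Nat.lt_succ_iff] using hk)) ⟨0, by simp⟩
    have hz1 : (1 : ℝ) ≤ z := by
      have : (0 : ℝ) < z := by rw [← hz']; positivity
      have : (0 : ℤ) < z := by exact_mod_cast this
      exact_mod_cast this
    have hle := sum_hypCoeff_le h0.le (show (1 : ℝ) / n < 1 by linarith) r zero_le_one le_rfl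
    simp only [one_pow, mul_one] at hle
    have hb := (h.bounds hn r).1
    have e4 : (1 + 1 : ℝ) ^ (2 * r) = 4 ^ r := by rw [pow_mul]; norm_num
    rw [e4] at hle
    calc (1 : ℝ) ≤ ρ * ∑ k ∈ range (r + 1), hypCoeff (1 / n : ℝ) r k := by rw [hz']; exact hz1
      _ ≤ ρ * (2 * lowerFactor (1 / n) r * 4 ^ r) := by gcongr
      _ = 2 * 4 ^ r * (lowerFactor (1 / n) r * ρ) := by ring
      _ < 2 * 4 ^ r * (C * (D / calN d n) ^ r) := by gcongr
      _ = _ := by rw [mul_pow]; ring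
  by_contra! hlt
  have hlim := tendsto_pow_atTop_nhds_zero_of_lt_one (r := 4 * (D / calN d n)) (by positivity)
    (by rw [← mul_div_assoc, div_lt_one hN]; exact hlt)
  have := ge_of_tendsto (hlim.const_mul (2 * C)) (Filter.Eventually.of_forall fun r => (key r).le)
  linarith

/-! ### Conjugation -/

/-- `z` and `z'` are obtained from each other by changing the sign of `S` in some representation
with rational coefficients. -/
def ConjPair (S z z' : ℂ) : Prop := ∃ A B : ℚ, z = A + B * S ∧ z' = A - B * S

namespace ConjPair

variable {S z z' y y' : ℂ} {t : ℤ}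

lemma symm (h : ConjPair S z z') : ConjPair S z' z := by
  obtain ⟨A, B, rfl, rfl⟩ := h
  exact ⟨A, -B, by push_cast; ring, by push_cast; ring⟩

lemma ratCast (q : ℚ) : ConjPair S q q := ⟨q, 0, by simp, by simp⟩

lemma intCast (q : ℤ) : ConjPair S q q := ⟨q, 0, by simp, by simp⟩

lemma neg (h : ConjPair S z z') : ConjPair S (-z) (-z') := by
  obtain ⟨A, B, rfl, rfl⟩ := h
  exact ⟨-A, -B, by push_cast; ring, by push_cast; ring⟩

lemma add (h : ConjPair S z z') (h' : ConjPair S y y') : ConjPair S (z + y) (z' + y') := by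
  obtain ⟨A, B, rfl, rfl⟩ := h
  obtain ⟨A', B', rfl, rfl⟩ := h'
  exact ⟨A + A', B + B', by push_cast; ring, by push_cast; ring⟩

lemma sub (h : ConjPair S z z') (h' : ConjPair S y y') : ConjPair S (z - y) (z' - y') := by
  rw [sub_eq_add_neg, sub_eq_add_neg]; exact h.add h'.neg

lemma mul (hS : S ^ 2 = t) (h : ConjPair S z z') (h' : ConjPair S y y') :
    ConjPair S (z * y) (z' * y') := by
  obtain ⟨A, B, rfl, rfl⟩ := h
  obtain ⟨A', B', rfl, rfl⟩ := h'
  refine ⟨A * A' + B * B' * t, A * B' + B * A', ?_, ?_⟩ <;> push_cast <;> rw [← hS] <;> ring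

lemma pow (hS : S ^ 2 = t) (h : ConjPair S z z') (k : ℕ) : ConjPair S (z ^ k) (z' ^ k) := by
  induction k with
  | zero => simpa using intCast (S := S) 1
  | succ k ih => rw [pow_succ, pow_succ]; exact ih.mul hS h

lemma sum {ι : Type*} (s : Finset ι) {f f' : ι → ℂ} (h : ∀ i ∈ s, ConjPair S (f i) (f' i)) :
    ConjPair S (∑ i ∈ s, f i) (∑ i ∈ s, f' i) := by
  classical
  induction s using Finset.induction_on with
  | empty => simpa using intCast (S := S) 0
  | insert i s hi ih =>
    rw [sum_insert hi, sum_insert hi]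
    exact (h i (mem_insert_self i s)).add (ih fun j hj => h j (mem_insert_of_mem hj))

lemma aeval (hS : S ^ 2 = t) (h : ConjPair S z z') (p : Polynomial ℤ) :
    ConjPair S (Polynomial.aeval z p) (Polynomial.aeval z' p) := by
  rw [Polynomial.aeval_eq_sum_range, Polynomial.aeval_eq_sum_range]
  refine sum _ fun i _ => ?_
  rw [zsmul_eq_mul, zsmul_eq_mul]
  exact (intCast _).mul hS (h.pow hS i)

end ConjPair

lemma coeff_eq_zero_of_not_isSquare {S : ℂ} {t : ℤ} (hS : S ^ 2 = t) (ht : ¬ IsSquare t) {A B : ℚ}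
    (h : (A : ℂ) + B * S = 0) : A = 0 ∧ B = 0 := by
  have hB : B = 0 := by
    by_contra hB
    apply ht
    have hB' : (B : ℂ) ≠ 0 := by exact_mod_cast hB
    have h2 : S = ((-A / B : ℚ) : ℂ) := by
      push_cast; field_simp; linear_combination h
    rw [h2] at hS
    have h3 : (-A / B : ℚ) ^ 2 = (t : ℚ) := by exact_mod_cast hS
    rw [← Rat.isSquare_intCast_iff]
    exact ⟨_, by rw [← h3, sq]⟩
  subst hB
  refine ⟨?_, rfl⟩
  simpa using h

/-- The monic polynomial annihilating z also annihilates z', since 1 and S are independent over ℚ.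
-/
lemma ConjPair.isIntegral {S z z' : ℂ} {t : ℤ} (hS : S ^ 2 = t) (ht : ¬ IsSquare t)
    (h : ConjPair S z z') (hz : IsIntegral ℤ z) : IsIntegral ℤ z' := by
  obtain ⟨p, hp, hpz⟩ := hz
  refine ⟨p, hp, ?_⟩
  rw [← Polynomial.aeval_def] at hpz ⊢
  obtain ⟨A, B, h1, h2⟩ := h.aeval hS p
  rw [hpz] at h1
  obtain ⟨rfl, rfl⟩ := coeff_eq_zero_of_not_isSquare hS ht h1.symm
  rw [h2]; simp

lemma exists_int_of_isIntegral_of_rat {z : ℂ} (hz : IsIntegral ℤ z) {q : ℚ} (hq : z = q) :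
    ∃ m : ℤ, z = m := by
  have h2 : IsIntegral ℤ q := by
    rw [hq] at hz
    exact (isIntegral_algebraMap_iff (algebraMap ℚ ℂ).injective (R := ℤ)).1 (by simpa using hz)
  obtain ⟨m, hm⟩ := IsIntegrallyClosed.isIntegral_iff.1 h2
  refine ⟨m, ?_⟩
  rw [hq, ← hm]; simp

lemma isIntegral_intCast (m : ℤ) : IsIntegral ℤ (m : ℂ) :=
  isIntegral_algebraMap (R := ℤ) (A := ℂ) (x := m)

/-! ### The scaling factor g -/

section

variable {u₁ u₂ t : ℤ}

lemma g₁_pos (hu : u₁ ≠ 0) : 0 < g₁ u₁ u₂ := Int.gcd_pos_of_ne_zero_left _ hu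

lemma div_g₁_ne_zero (hu : u₁ ≠ 0) : u₁ / g₁ u₁ u₂ ≠ 0 := by
  intro h
  have := Int.ediv_mul_cancel (Int.gcd_dvd_left (a := u₁) (b := u₂))
  rw [← g₁, h, zero_mul] at this
  exact hu this.symm

lemma g₂_pos (hu : u₁ ≠ 0) : 0 < g₂ u₁ u₂ t :=
  Int.gcd_pos_of_ne_zero_left _ (div_g₁_ne_zero hu)

lemma g₃_pos : 0 < g₃ u₁ u₂ t := by
  unfold g₃; split_ifs <;> norm_num

lemma sqfCore_pos (N : ℕ) : 0 < sqfCore N :=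
  prod_pos fun _ hp => (Nat.prime_of_mem_primeFactors (mem_filter.1 hp).1).pos

lemma g₄_pos (n : ℕ) : 0 < g₄ n u₁ u₂ t := Nat.gcd_pos_of_pos_left _ (sqfCore_pos _)

lemma gTot_pos (n : ℕ) (hu : u₁ ≠ 0) : 0 < gTot n u₁ u₂ t := by
  have h1 : (0 : ℝ) < g₁ u₁ u₂ := by exact_mod_cast g₁_pos hu
  have h2 : (0 : ℝ) < g₂ u₁ u₂ t := by exact_mod_cast g₂_pos hu
  have h3 : (0 : ℝ) < g₃ u₁ u₂ t := by exact_mod_cast g₃_pos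
  have h4 : (0 : ℝ) < g₄ n u₁ u₂ t := by exact_mod_cast g₄_pos n
  unfold gTot
  positivity

lemma gTot_sq (n : ℕ) : gTot n u₁ u₂ t ^ 2 =
    (g₁ u₁ u₂ : ℝ) ^ 2 * g₂ u₁ u₂ t / (g₃ u₁ u₂ t * g₄ n u₁ u₂ t) := by
  rw [gTot, div_pow, mul_pow, Real.sq_sqrt (by positivity), Real.sq_sqrt (by positivity)]

/-- The core is squarefree and divides (2g₂)², because g₃ divides 4. So it divides 2g₂, and g₂
divides t. -/
lemma sqfCore_le (hu : u₁ ≠ 0) (ht : t ≠ 0) :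
    sqfCore (g₂ u₁ u₂ t * g₃ u₁ u₂ t) ≤ 2 * t.natAbs := by
  have h2 := g₂_pos (u₂ := u₂) (t := t) hu
  have h3 := g₃_pos (u₁ := u₁) (u₂ := u₂) (t := t)
  obtain ⟨hsf, k, hk⟩ := sqfCore_spec (N := g₂ u₁ u₂ t * g₃ u₁ u₂ t) (by positivity)
  have hg2 : g₂ u₁ u₂ t ≤ t.natAbs :=
    Nat.le_of_dvd (Int.natAbs_pos.2 ht) (Int.natCast_dvd.1 (Int.gcd_dvd_right ..))
  have hdvd : sqfCore (g₂ u₁ u₂ t * g₃ u₁ u₂ t) ∣ (2 * g₂ u₁ u₂ t) ^ 2 := by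
    refine (Dvd.intro _ hk.symm).trans ?_
    have : g₃ u₁ u₂ t ∣ 4 := by
      unfold g₃; split_ifs <;> norm_num
    rw [mul_pow, mul_comm, sq (g₂ u₁ u₂ t)]
    exact mul_dvd_mul (by simpa using this) (dvd_mul_right _ _)
  have := (hsf.dvd_pow_iff_dvd two_ne_zero).1 hdvd
  exact (Nat.le_of_dvd (by positivity) this).trans (by omega)

/-- `g` is a rational multiple of the square root of a small natural number. -/
lemma exists_gTot_eq (n : ℕ) (hu : u₁ ≠ 0) (ht : t ≠ 0) :
    ∃ (q : ℚ) (m : ℕ), 0 < m ∧ (m : ℝ) ≤ |2 * (t : ℝ)| ∧ gTot n u₁ u₂ t = q * √m := by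
  have h2 := g₂_pos (u₂ := u₂) (t := t) hu
  have h3 := g₃_pos (u₁ := u₁) (u₂ := u₂) (t := t)
  have h4 := g₄_pos (u₁ := u₁) (u₂ := u₂) (t := t) n
  obtain ⟨_, k, hk⟩ := sqfCore_spec (N := g₂ u₁ u₂ t * g₃ u₁ u₂ t) (by positivity)
  obtain ⟨m, hm⟩ : g₄ n u₁ u₂ t ∣ sqfCore (g₂ u₁ u₂ t * g₃ u₁ u₂ t) := Nat.gcd_dvd_left _ _
  have hm0 : 0 < m := by
    rcases Nat.eq_zero_or_pos m with rfl | h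
    · have := sqfCore_pos (g₂ u₁ u₂ t * g₃ u₁ u₂ t)
      rw [hm] at this; simp at this
    · exact h
  -- With g₂g₃ = core · k² and core = g₄ m, one gets g² = g₁² g₂/(g₃g₄) = (g₁k/g₃)² m.
  refine ⟨g₁ u₁ u₂ * k / g₃ u₁ u₂ t, m, hm0, ?_, ?_⟩
  · have hle := sqfCore_le (u₂ := u₂) hu ht
    rw [hm] at hle
    have h5 : m ≤ 2 * t.natAbs := le_trans (Nat.le_mul_of_pos_left m h4) hle
    have h6 : (m : ℝ) ≤ 2 * (t.natAbs : ℝ) := by exact_mod_cast h5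
    rw [Nat.cast_natAbs, Int.cast_abs] at h6
    rw [abs_mul]; simpa using h6
  · rw [hm] at hk
    have hk' : (g₂ u₁ u₂ t : ℝ) * g₃ u₁ u₂ t = g₄ n u₁ u₂ t * m * k ^ 2 := by exact_mod_cast hk
    have h3' : (0 : ℝ) < g₃ u₁ u₂ t := by exact_mod_cast h3
    have h4' : (0 : ℝ) < g₄ n u₁ u₂ t := by exact_mod_cast h4
    have hm' : (0 : ℝ) < m := by exact_mod_cast hm0
    rw [← abs_of_pos (gTot_pos n hu), ← abs_of_nonneg (a := ((_ : ℚ) : ℝ) * √m) (by positivity),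
      ← sq_eq_sq_iff_abs_eq_abs, gTot_sq, mul_pow, Real.sq_sqrt hm'.le]
    push_cast
    field_simp
    linear_combination (g₁ u₁ u₂ : ℝ) ^ 2 * hk'

/-- It suffices that the square be integral. There √g₂ and √(g₃g₄) disappear, and g₄ enters only as
an integer factor. -/
lemma isIntegral_div_gTot (n : ℕ) (hu : u₁ ≠ 0) {S : ℂ} (hS : S ^ 2 = t) :
    IsIntegral ℤ (((u₁ : ℂ) + u₂ * S) / 2 / (gTot n u₁ u₂ t : ℝ)) := by
  have hS' : IsIntegral ℤ S := IsIntegral.of_pow two_pos (by rw [hS]; exact isIntegral_intCast t)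
  obtain ⟨a, ha⟩ : ((g₁ u₁ u₂ : ℕ) : ℤ) ∣ u₁ := Int.gcd_dvd_left ..
  obtain ⟨b, hb⟩ : ((g₁ u₁ u₂ : ℕ) : ℤ) ∣ u₂ := Int.gcd_dvd_right ..
  have hg1 := g₁_pos (u₂ := u₂) hu
  have hg1z : ((g₁ u₁ u₂ : ℕ) : ℤ) ≠ 0 := by exact_mod_cast hg1.ne'
  have hda : u₁ / g₁ u₁ u₂ = a := Int.ediv_eq_of_eq_mul_right hg1z ha
  have hdab : (u₁ - u₂) / g₁ u₁ u₂ = a - b :=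
    Int.ediv_eq_of_eq_mul_right hg1z (by rw [mul_sub, ← ha, ← hb])
  obtain ⟨a', ha'⟩ : ((g₂ u₁ u₂ t : ℕ) : ℤ) ∣ a := by
    rw [← hda]; exact Int.gcd_dvd_left ..
  obtain ⟨t', ht'⟩ : ((g₂ u₁ u₂ t : ℕ) : ℤ) ∣ t := Int.gcd_dvd_right ..
  have hg2 := g₂_pos (u₂ := u₂) (t := t) hu
  obtain ⟨G1, hG1⟩ : ∃ G : ℤ, G = (g₁ u₁ u₂ : ℕ) := ⟨_, rfl⟩
  obtain ⟨G2, hG2⟩ : ∃ G : ℤ, G = (g₂ u₁ u₂ t : ℕ) := ⟨_, rfl⟩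
  have hG1c : (g₁ u₁ u₂ : ℂ) = G1 := by rw [hG1]; simp
  have hG2c : (g₂ u₁ u₂ t : ℂ) = G2 := by rw [hG2]; simp
  have hG10 : (G1 : ℂ) ≠ 0 := by rw [← hG1c]; exact_mod_cast hg1.ne'
  have hG20 : (G2 : ℂ) ≠ 0 := by rw [← hG2c]; exact_mod_cast hg2.ne'
  rw [← hG1] at ha hb
  rw [← hG2] at ha' ht'
  -- This is the square without its factor g₄, with u₁ = g₁g₂a', u₂ = g₁b and t = g₂t'. If g₃ = 1 it
  -- is an integer combination of 1 and (1 + √t)/2; if g₃ = 2 its rational part is integral because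
  -- g₂a'² + b²t' is even; if g₃ = 4 nothing is left to divide.
  have hmain : IsIntegral ℤ (((G2 * a' ^ 2 + b ^ 2 * t' : ℤ) + 2 * a' * b * S) *
      g₃ u₁ u₂ t / 4) := by
    have hg3 : g₃ u₁ u₂ t = if t ≡ 1 [ZMOD 4] ∧ a - b ≡ 0 [ZMOD 2] then 1
        else if t ≡ 3 [ZMOD 4] ∧ a - b ≡ 0 [ZMOD 2] then 2 else 4 := by
      rw [g₃, hdab]
    rw [hg3]
    split_ifs with h1 h3
    · obtain ⟨h1, h2⟩ := h1
      have hG2odd : G2 % 2 = 1 := by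
        rcases Int.emod_two_eq_zero_or_one G2 with h | h
        · exfalso
          obtain ⟨k, hk⟩ := Int.dvd_of_emod_eq_zero h
          rw [ht', hk, Int.ModEq, mul_assoc] at h1
          omega
        · exact h
      obtain ⟨m, hm⟩ : ∃ m, G2 = 2 * m + 1 := ⟨G2 / 2, by omega⟩
      obtain ⟨k, hk⟩ : ∃ k, a' = b + 2 * k := by
        have : a - b = 2 * (m * a') + a' - b := by rw [ha', hm]; ring
        rw [this] at h2
        exact ⟨(a' - b) / 2, by unfold Int.ModEq at h2; omega⟩
      obtain ⟨l, hl⟩ : ∃ l, t' = G2 + 4 * l := by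
        refine ⟨(t' - G2) / 4, ?_⟩
        have h4 : t = 2 * (m * t') + t' := by rw [ht', hm]; ring
        have h5 : t' % 2 = 1 := by unfold Int.ModEq at h1; omega
        obtain ⟨e, he⟩ : ∃ e, t' = 2 * e + 1 := ⟨t' / 2, by omega⟩
        have h6 : t = 4 * (m * e) + 2 * m + 2 * e + 1 := by rw [h4, he]; ring
        unfold Int.ModEq at h1; omega
      obtain ⟨j, hj⟩ : ∃ j, t = 1 + 4 * j := ⟨t / 4, by unfold Int.ModEq at h1; omega⟩
      have hθ : IsIntegral ℤ ((1 + S) / 2) := by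
        refine ⟨Polynomial.X ^ 2 - (Polynomial.X + Polynomial.C j), ?_, ?_⟩
        · exact Polynomial.monic_X_pow_sub (by
            rw [Polynomial.degree_X_add_C]; norm_num)
        · have : S ^ 2 = 1 + 4 * j := by rw [hS, hj]; push_cast; ring
          simp only [Polynomial.eval₂_sub, Polynomial.eval₂_pow, Polynomial.eval₂_X,
            Polynomial.eval₂_add, Polynomial.eval₂_C, algebraMap_int_eq]
          simp only [eq_intCast]
          linear_combination this / 4
      have e : ((G2 * a' ^ 2 + b ^ 2 * t' : ℤ) + 2 * a' * b * S) * ((1 : ℕ) : ℂ) / 4 =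
          ((a' * b : ℤ) : ℂ) * ((1 + S) / 2) +
            ((m * b ^ 2 + G2 * k * b + G2 * k ^ 2 + b ^ 2 * l - k * b : ℤ) : ℂ) := by
        rw [hl, hk, hm]
        push_cast
        ring
      rw [e]
      exact ((isIntegral_intCast _).mul hθ).add (isIntegral_intCast _)
    · obtain ⟨h1, h2⟩ := h3
      have hpar : (G2 * a' ^ 2 + b ^ 2 * t') % 2 = 0 := by
        have hG2odd : G2 % 2 = 1 := by
          rcases Int.emod_two_eq_zero_or_one G2 with h | h
          · exfalso
            obtain ⟨k, hk⟩ := Int.dvd_of_emod_eq_zero h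
            rw [ht', hk, Int.ModEq, mul_assoc] at h1
            omega
          · exact h
        obtain ⟨m, hm⟩ : ∃ m, G2 = 2 * m + 1 := ⟨G2 / 2, by omega⟩
        obtain ⟨k, hk⟩ : ∃ k, a' = b + 2 * k := by
          have : a - b = 2 * (m * a') + a' - b := by rw [ha', hm]; ring
          rw [this] at h2
          exact ⟨(a' - b) / 2, by unfold Int.ModEq at h2; omega⟩
        have h4 : t = 2 * (m * t') + t' := by rw [ht', hm]; ring
        have h5 : t' % 2 = 1 := by unfold Int.ModEq at h1; omega
        obtain ⟨e, he⟩ : ∃ e, t' = 2 * e + 1 := ⟨t' / 2, by omega⟩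
        rw [show G2 * a' ^ 2 + b ^ 2 * t' = 2 * (m * a' ^ 2 + b ^ 2 + 2 * b * k + 2 * k ^ 2 + b ^ 2 * e) by
          rw [hm, hk, he]; ring]
        omega
      obtain ⟨c, hc⟩ := Int.dvd_of_emod_eq_zero hpar
      have e : ((G2 * a' ^ 2 + b ^ 2 * t' : ℤ) + 2 * a' * b * S) * ((2 : ℕ) : ℂ) / 4 =
          (c : ℂ) + ((a' * b : ℤ) : ℂ) * S := by
        rw [hc]; push_cast; ring
      rw [e]
      exact (isIntegral_intCast _).add ((isIntegral_intCast _).mul hS')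
    · have e : ((G2 * a' ^ 2 + b ^ 2 * t' : ℤ) + 2 * a' * b * S) * ((4 : ℕ) : ℂ) / 4 =
          ((G2 * a' ^ 2 + b ^ 2 * t' : ℤ) : ℂ) + ((2 * a' * b : ℤ) : ℂ) * S := by
        push_cast; ring
      rw [e]
      exact (isIntegral_intCast _).add ((isIntegral_intCast _).mul hS')
  refine IsIntegral.of_pow two_pos ?_
  have hgs : ((gTot n u₁ u₂ t : ℝ) : ℂ) ^ 2 =
      (G1 : ℂ) ^ 2 * G2 / (g₃ u₁ u₂ t * g₄ n u₁ u₂ t) := by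
    have := congrArg (fun x : ℝ => (x : ℂ)) (gTot_sq (u₁ := u₁) (u₂ := u₂) (t := t) n)
    push_cast at this
    rw [this, hG1c, hG2c]
  have h3c : (g₃ u₁ u₂ t : ℂ) ≠ 0 := by exact_mod_cast g₃_pos.ne'
  have h4c : (g₄ n u₁ u₂ t : ℂ) ≠ 0 := by exact_mod_cast (g₄_pos n).ne'
  have e : (((u₁ : ℂ) + u₂ * S) / 2 / (gTot n u₁ u₂ t : ℝ)) ^ 2 =
      (((G2 * a' ^ 2 + b ^ 2 * t' : ℤ) + 2 * a' * b * S) * g₃ u₁ u₂ t / 4) *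
        ((g₄ n u₁ u₂ t : ℤ) : ℂ) := by
    have hu1c : (u₁ : ℂ) = G1 * (G2 * a') := by rw [ha, ha']; push_cast; ring
    have hu2c : (u₂ : ℂ) = G1 * b := by rw [hb]; push_cast; ring
    have htc : S ^ 2 = G2 * t' := by rw [hS, ht']; push_cast; ring
    rw [div_pow, hgs, hu1c, hu2c]
    push_cast
    field_simp
    linear_combination (4 : ℂ) * b ^ 2 * htc
  rw [e]
  exact hmain.mul (isIntegral_intCast _)

end

/-! ### From approximations to an irrationality measure -/

/-- A sequence of good rational approximations to `θ` yields an effective irrationality measure. -/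
lemma irrationality_measure {θ : ℂ} {P R : ℕ → ℤ} {k₀ l₀ E Q κ : ℝ} (hk : 0 < k₀)
    (hE : 1 < E) (hQ0 : 0 < Q) (hR : ∀ r, (|(R r : ℝ)|) < k₀ * Q ^ r)
    (hP : ∀ r, ‖(R r : ℂ) * θ - P r‖ * E ^ r ≤ l₀)
    (hdet : ∀ r, P r * R (r + 1) - P (r + 1) * R r ≠ 0) (hκ : κ = Real.log Q / Real.log E)
    (p q : ℤ) (hq : q ≠ 0) :
    1 / (2 * k₀ * Q * (max 1 (2 * l₀ * E)) ^ κ * |(q : ℝ)| ^ (κ + 1)) < ‖θ - (p : ℂ) / q‖ := by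
  have hE0 : 0 < E := by linarith
  have hlogE : 0 < Real.log E := Real.log_pos hE
  -- If Q < 1 the integers R r would eventually be 0, against the determinant condition.
  have hQ1 : 1 ≤ Q := by
    by_contra! hlt
    have hlim : Filter.Tendsto (fun r => k₀ * Q ^ r) Filter.atTop (nhds (k₀ * 0)) :=
      (tendsto_pow_atTop_nhds_zero_of_lt_one hQ0.le hlt).const_mul k₀
    rw [mul_zero] at hlim
    obtain ⟨r, hr⟩ := Filter.eventually_atTop.1 (hlim.eventually_lt_const one_pos)
    have hz : ∀ s ≥ r, R s = 0 := by
      intro s hs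
      have h1 : |(R s : ℝ)| < 1 := (hR s).trans (hr s hs)
      have h2 : |R s| < 1 := by exact_mod_cast h1
      exact Int.abs_lt_one_iff.1 h2
    exact hdet r (by rw [hz r le_rfl, hz (r + 1) (by omega)]; ring)
  have hκ0 : 0 ≤ κ := by rw [hκ]; exact div_nonneg (Real.log_nonneg hQ1) hlogE.le
  have hEκ : E ^ κ = Q := by
    rw [hκ, Real.rpow_def_of_pos hE0, mul_div_cancel₀ _ hlogE.ne', Real.exp_log hQ0]
  set b := |(q : ℝ)| with hb
  have hb1 : 1 ≤ b := by
    rw [hb]; exact_mod_cast Int.one_le_abs hq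
  have hb0 : 0 < b := by linarith
  set M := max 1 (2 * l₀ * E) with hM
  have hM1 : 1 ≤ M := le_max_left _ _
  have hM2 : 2 * l₀ * E ≤ M := le_max_right _ _
  have hex : ∃ r : ℕ, 2 * l₀ * b ≤ E ^ r :=
    (pow_unbounded_of_one_lt (2 * l₀ * b) hE).imp fun _ h => h.le
  classical
  -- From r₀ on, |q| ‖R θ - P‖ ≤ 1/2. Minimality bounds E^r₀ by M|q| when r₀ > 0, and Q = E^κ
  -- transfers this bound to Q^r₀.
  set r₀ := Nat.find hex with hr₀
  have hr₀spec : 2 * l₀ * b ≤ E ^ r₀ := Nat.find_spec hex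
  have hQr : Q ^ r₀ ≤ (M * b) ^ κ := by
    rcases Nat.eq_zero_or_pos r₀ with h0 | hpos
    · rw [h0, pow_zero]
      exact Real.one_le_rpow (by nlinarith) hκ0
    · have hmin := Nat.find_min hex (m := r₀ - 1) (by omega)
      push Not at hmin
      have h1 : E ^ r₀ ≤ M * b := by
        calc E ^ r₀ = E ^ (r₀ - 1) * E := by rw [← pow_succ]; congr 1; omega
          _ ≤ 2 * l₀ * b * E := by gcongr
          _ = 2 * l₀ * E * b := by ring
          _ ≤ M * b := by gcongr
      calc Q ^ r₀ = (E ^ r₀) ^ κ := by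
            rw [← hEκ, ← Real.rpow_natCast, ← Real.rpow_natCast, ← Real.rpow_mul hE0.le,
              ← Real.rpow_mul hE0.le, mul_comm]
        _ ≤ _ := Real.rpow_le_rpow (by positivity) h1 hκ0
  have hqc : (q : ℂ) ≠ 0 := by exact_mod_cast hq
  have hqn : ‖(q : ℂ)‖ = b := by rw [Complex.norm_intCast]
  -- By the determinant, p/q cannot equal both P/R at r₀ and at r₀ + 1. The possible shift by one
  -- costs the factor Q in the constant.
  obtain ⟨r, hrle, hrge, hne⟩ : ∃ r, r ≤ r₀ + 1 ∧ r₀ ≤ r ∧ P r * q - R r * p ≠ 0 := by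
    by_contra! hcon
    have h1 := hcon r₀ (by omega) le_rfl
    have h2 := hcon (r₀ + 1) le_rfl (by omega)
    apply hdet r₀
    have : q * (P r₀ * R (r₀ + 1) - P (r₀ + 1) * R r₀) = 0 := by
      linear_combination R (r₀ + 1) * h1 - R r₀ * h2
    exact (mul_eq_zero.1 this).resolve_left hq
  have hkey : 1 ≤ |(R r : ℝ)| * b * ‖θ - (p : ℂ) / q‖ + 1 / 2 := by
    have e : ((P r * q - R r * p : ℤ) : ℂ) =
        R r * q * (θ - p / q) - q * (R r * θ - P r) := by
      push_cast; field_simp; ring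
    have h1 : (1 : ℝ) ≤ ‖((P r * q - R r * p : ℤ) : ℂ)‖ := by
      rw [Complex.norm_intCast]; exact_mod_cast Int.one_le_abs hne
    rw [e] at h1
    refine h1.trans ((norm_sub_le _ _).trans ?_)
    rw [norm_mul, norm_mul, norm_mul, hqn, Complex.norm_intCast]
    have h2 : b * ‖(R r : ℂ) * θ - P r‖ ≤ 1 / 2 := by
      have hEr : 2 * l₀ * b ≤ E ^ r := hr₀spec.trans (pow_le_pow_right₀ hE.le hrge)
      have h3 := hP r
      have hEp : 0 < E ^ r := by positivity
      have h4 : b * ‖(R r : ℂ) * θ - P r‖ * E ^ r ≤ 1 / 2 * E ^ r := by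
        calc _ = b * (‖(R r : ℂ) * θ - P r‖ * E ^ r) := by ring
          _ ≤ b * l₀ := by gcongr
          _ ≤ _ := by linarith
      exact le_of_mul_le_mul_right h4 hEp
    linarith
  set δ := ‖θ - (p : ℂ) / q‖ with hδ
  have hδ0 : 0 < δ := by
    by_contra! h
    have h1 : |(R r : ℝ)| * b * δ ≤ 0 := mul_nonpos_of_nonneg_of_nonpos (by positivity) h
    linarith
  have hRr : |(R r : ℝ)| < k₀ * (Q * (M * b) ^ κ) := by
    refine (hR r).trans_le ?_
    have : Q ^ r ≤ Q * (M * b) ^ κ := by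
      calc Q ^ r ≤ Q ^ (r₀ + 1) := pow_le_pow_right₀ hQ1 hrle
        _ = Q * Q ^ r₀ := by ring
        _ ≤ _ := by gcongr
    gcongr
  have hM0 : 0 < M := by linarith
  rw [Real.mul_rpow hM0.le hb0.le] at hRr
  rw [Real.rpow_add hb0, Real.rpow_one, div_lt_iff₀ (by positivity)]
  have h5 : |(R r : ℝ)| * (b * δ) < k₀ * (Q * (M ^ κ * b ^ κ)) * (b * δ) := by gcongr
  nlinarith

/-! ### Integrality of the approximations -/

lemma pow_mul_hypVal (α : ℝ) (r : ℕ) {u z : ℂ} (hu : u ≠ 0) :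
    u ^ r * hypVal α r (z / u) =
      ∑ k ∈ range (r + 1), hypCoeff (α : ℂ) r k * (z ^ k * u ^ (r - k)) := by
  rw [hypVal, mul_sum]
  refine sum_congr rfl fun k hk => ?_
  have hk : k ≤ r := by simpa [Nat.lt_succ_iff] using hk
  obtain ⟨m, rfl⟩ := Nat.exists_eq_add_of_le hk
  rw [Nat.add_sub_cancel_left, div_pow, pow_add]
  field_simp

lemma pow_mul_hypRev (α : ℝ) (r : ℕ) {u z : ℂ} (hu : u ≠ 0) :
    u ^ r * hypRev α r (z / u) =
      ∑ k ∈ range (r + 1), hypCoeff (α : ℂ) r k * (u ^ k * z ^ (r - k)) := by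
  rw [hypRev, mul_sum]
  refine sum_congr rfl fun k hk => ?_
  have hk : k ≤ r := by simpa [Nat.lt_succ_iff] using hk
  obtain ⟨m, rfl⟩ := Nat.exists_eq_add_of_le hk
  rw [Nat.add_sub_cancel_left, div_pow, pow_add]
  field_simp

lemma hypCoeff_one_div_eq_ratCast (n r k : ℕ) :
    hypCoeff ((1 / n : ℝ) : ℂ) r k = ((hypCoeff (1 / n : ℚ) r k : ℚ) : ℂ) := by
  have := map_hypCoeff (Rat.castHom ℂ) (1 / n : ℚ) r k
  simpa using this.symm

/-- A scaling factor that turns the algebraic approximations into rational integers. -/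
lemma exists_int_scale {n : ℕ} (hn : 2 ≤ n) {t u₁ u₂ : ℤ} (ht : t ≠ 0) (hu : u₁ ≠ 0) {S : ℂ}
    (hS : S ^ 2 = t) {U Z : ℂ} (hU : U = (u₁ + u₂ * S) / 2) (hZ : Z = (-u₁ + u₂ * S) / 2)
    (hU0 : U ≠ 0) (hZ0 : Z ≠ 0) {d : ℕ} (hd : 0 < d)
    (hdg : IsIntegral ℤ ((u₁ : ℂ) / (d * (gTot n u₁ u₂ t : ℝ)))) (r : ℕ) :
    ∃ τ : ℂ, τ ≠ 0 ∧ ‖τ‖ ≤ √|2 * (t : ℝ)| ∧ ∀ c₁ c₂ : ℂ, ConjPair S c₁ c₂ → IsIntegral ℤ c₁ →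
      IsIntegral ℤ c₂ → ∃ m : ℤ, τ * ((denom n r : ℂ) / numGcd d n r) /
        ((gTot n u₁ u₂ t : ℝ) : ℂ) ^ r * (c₁ * (U ^ r * hypVal (1 / n) r (Z / U)) -
          c₂ * (U ^ r * hypRev (1 / n) r (Z / U))) = m := by
  have hS' : IsIntegral ℤ S := IsIntegral.of_pow two_pos (by rw [hS]; exact isIntegral_intCast t)
  have hS0 : S ≠ 0 := by
    rintro rfl
    apply ht
    have : (t : ℂ) = 0 := by rw [← hS]; norm_num
    exact_mod_cast this
  set g : ℂ := ((gTot n u₁ u₂ t : ℝ) : ℂ) with hg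
  have hg0 : g ≠ 0 := by rw [hg]; exact_mod_cast (gTot_pos n hu).ne'
  have hdc : (d : ℂ) ≠ 0 := by exact_mod_cast hd.ne'
  set X := U ^ r * hypVal (1 / n) r (Z / U) with hX
  set Y := U ^ r * hypRev (1 / n) r (Z / U) with hY
  have hY' : Y = Z ^ r * hypVal (1 / n) r (U / Z) := by
    rw [hY, pow_mul_hypRev _ _ hU0, pow_mul_hypVal _ _ hZ0]
  set ρ : ℂ := (denom n r : ℂ) / numGcd d n r with hρ
  have hUg : IsIntegral ℤ (U / g) := by rw [hU]; exact isIntegral_div_gTot n hu hS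
  have hZg : IsIntegral ℤ (Z / g) := by
    have := isIntegral_div_gTot (u₂ := u₂) n hu (S := -S) (by rw [neg_sq, hS])
    have h2 := this.neg
    convert! h2 using 1
    rw [hZ]; ring
  -- Since U - Z = u₁ = d · (u₁/d), the argument Z/U is 1 - d (u₁/d)/U, which is where N_{d,n,r}
  -- applies.
  have hXi : IsIntegral ℤ (ρ * X / g ^ r) := by
    have := isIntegral_hypVal hn d r (f := (u₁ : ℂ) / d) (g := g) hU0 hUg (by rwa [div_div])
    rwa [mul_div_cancel₀ _ hdc, show U - u₁ = Z by rw [hU, hZ]; ring] at this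
  have hYi : IsIntegral ℤ (ρ * Y / g ^ r) := by
    have := isIntegral_hypVal hn d r (f := -((u₁ : ℂ) / d)) (g := g) hZ0 hZg (by
      rw [neg_div, div_div]; exact hdg.neg)
    rwa [mul_neg, mul_div_cancel₀ _ hdc, show Z - -(u₁ : ℂ) = U by rw [hU, hZ]; ring, ← hY'] at this
  have hUZ : ConjPair S U (-Z) := ⟨u₁ / 2, u₂ / 2, by rw [hU]; push_cast; ring,
    by rw [hZ]; push_cast; ring⟩
  have hZU : ConjPair S Z (-U) := by simpa using hUZ.symm.neg
  have hcoe : ∀ k, ConjPair S (hypCoeff (((1 : ℝ) / n : ℝ) : ℂ) r k)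
      (hypCoeff (((1 : ℝ) / n : ℝ) : ℂ) r k) := fun k => by
    rw [hypCoeff_one_div_eq_ratCast]; exact ConjPair.ratCast _
  have hsign : ∀ a b : ℂ, ∑ k ∈ range (r + 1),
      hypCoeff (((1 : ℝ) / n : ℝ) : ℂ) r k * ((-a) ^ k * (-b) ^ (r - k)) = (-1) ^ r *
      ∑ k ∈ range (r + 1), hypCoeff (((1 : ℝ) / n : ℝ) : ℂ) r k * (a ^ k * b ^ (r - k)) := by
    intro a b
    rw [mul_sum]
    refine sum_congr rfl fun k hk => ?_
    have hk : k ≤ r := by simpa [Nat.lt_succ_iff] using hk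
    obtain ⟨m, rfl⟩ := Nat.exists_eq_add_of_le hk
    rw [Nat.add_sub_cancel_left, neg_pow a, neg_pow b, pow_add]; ring
  have hXY : ConjPair S X ((-1) ^ r * Y) := by
    rw [hX, hY, pow_mul_hypVal _ _ hU0, pow_mul_hypRev _ _ hU0, ← hsign]
    exact ConjPair.sum _ fun k _ => (hcoe k).mul hS ((hZU.pow hS k).mul hS (hUZ.pow hS _))
  have hYX : ConjPair S Y ((-1) ^ r * X) := by
    rw [hX, hY, pow_mul_hypVal _ _ hU0, pow_mul_hypRev _ _ hU0, ← hsign]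
    exact ConjPair.sum _ fun k _ => (hcoe k).mul hS ((hUZ.pow hS k).mul hS (hZU.pow hS _))
  have hTint : ∀ τ c₁ c₂ : ℂ, IsIntegral ℤ τ → IsIntegral ℤ c₁ → IsIntegral ℤ c₂ →
      IsIntegral ℤ (τ * ρ / g ^ r * (c₁ * X - c₂ * Y)) := by
    intro τ c₁ c₂ hτ h1 h2
    have e : τ * ρ / g ^ r * (c₁ * X - c₂ * Y) =
        τ * (c₁ * (ρ * X / g ^ r) - c₂ * (ρ * Y / g ^ r)) := by ring
    rw [e]
    exact hτ.mul ((h1.mul hXi).sub (h2.mul hYi))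
  have hT : ∀ c₁ c₂ : ℂ, ConjPair S c₁ c₂ → ConjPair S (c₁ * X - c₂ * Y)
      (-(-1) ^ r * (c₁ * X - c₂ * Y)) := by
    intro c₁ c₂ hc
    have := (hc.mul hS hXY).sub (hc.symm.mul hS hYX)
    convert! this using 1
    ring
  obtain ⟨q, m, hm0, hm, hgq⟩ := exists_gTot_eq (u₂ := u₂) n hu ht
  have hgq' : g = q * ((√m : ℝ) : ℂ) := by rw [hg, hgq]; push_cast; rfl
  have hm2 : ((√m : ℝ) : ℂ) ^ 2 = m := by
    rw [← Complex.ofReal_pow, Real.sq_sqrt (by positivity)]; simp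
  have hmr : ((√m : ℝ) : ℂ) ≠ 0 := by
    have : (0 : ℝ) < m := by exact_mod_cast hm0
    exact_mod_cast (Real.sqrt_pos.2 this).ne'
  rcases Nat.even_or_odd r with hr | hr
  -- For even r the combination is a rational multiple B S and g^r is rational, so multiplying by S
  -- gives a rational number.
  · refine ⟨S, hS0, ?_, fun c₁ c₂ hc h1 h2 => ?_⟩
    · have hn2 : ‖S‖ ^ 2 = |(t : ℝ)| := by rw [← norm_pow, hS, Complex.norm_intCast]
      rw [Real.le_sqrt (norm_nonneg _) (by positivity), hn2, abs_mul]
      norm_num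
      linarith [abs_nonneg (t : ℝ)]
    · obtain ⟨A, B, e1, e2⟩ := hT c₁ c₂ hc
      rw [hr.neg_one_pow] at e2
      have hTB : c₁ * X - c₂ * Y = B * S := by linear_combination (1 / 2) * e1 - (1 / 2) * e2
      obtain ⟨j, rfl⟩ := hr
      have hgr : g ^ (j + j) = ((q ^ 2 * m) ^ j : ℚ) := by
        rw [← two_mul, pow_mul, hgq', mul_pow, hm2]; push_cast; ring
      refine exists_int_of_isIntegral_of_rat (hTint S c₁ c₂ hS' h1 h2)
        (q := t * (denom n (j + j) / numGcd d n (j + j)) / (q ^ 2 * m) ^ j * B) ?_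
      rw [hTB, hgr, hρ]
      push_cast
      rw [← hS]
      ring
  · have hmi : IsIntegral ℤ ((√m : ℝ) : ℂ) :=
      IsIntegral.of_pow two_pos (by rw [hm2]; exact_mod_cast isIntegral_intCast m)
    -- For odd r the combination is rational and g^r is a rational multiple of √m, which this factor
    -- cancels.
    refine ⟨((√m : ℝ) : ℂ), hmr, ?_, fun c₁ c₂ hc h1 h2 => ?_⟩
    · rw [Complex.norm_real, Real.norm_of_nonneg (Real.sqrt_nonneg _)]
      exact Real.sqrt_le_sqrt hm
    · obtain ⟨A, B, e1, e2⟩ := hT c₁ c₂ hc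
      rw [hr.neg_one_pow] at e2
      have hTA : c₁ * X - c₂ * Y = A := by linear_combination (1 / 2) * e1 + (1 / 2) * e2
      obtain ⟨j, rfl⟩ := hr
      have hgr : g ^ (2 * j + 1) = ((q ^ (2 * j + 1) * m ^ j : ℚ) : ℂ) * ((√m : ℝ) : ℂ) := by
        rw [hgq', mul_pow, pow_succ ((√m : ℝ) : ℂ), pow_mul ((√m : ℝ) : ℂ), hm2]
        push_cast; ring
      refine exists_int_of_isIntegral_of_rat (hTint _ c₁ c₂ hmi h1 h2)
        (q := (denom n (2 * j + 1) / numGcd d n (2 * j + 1)) / (q ^ (2 * j + 1) * m ^ j) * A) ?_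
      rw [hTA, hgr, hρ]
      push_cast
      rw [mul_comm ((√m : ℝ) : ℂ), mul_div_mul_right _ _ hmr]

/-! ### The growth rates in terms of U and W -/

lemma norm_one_sub_le_norm_one_add {y : ℂ} (hy : 0 ≤ y.re) : ‖1 - y‖ ≤ ‖1 + y‖ := by
  rw [← abs_of_nonneg (norm_nonneg (1 - y)), ← abs_of_nonneg (norm_nonneg (1 + y)),
    ← sq_le_sq, ← Complex.normSq_eq_norm_sq, ← Complex.normSq_eq_norm_sq, Complex.normSq_apply,
    Complex.normSq_apply]
  simp
  nlinarith

/-- With y = √(Z/U) one has s = ±2Uy, so a ± s are U(1 + y)² and U(1 - y)² in some order. Re y ≥ 0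
decides which is larger. -/
lemma min_max_norm_eq {U Z s a : ℂ} (hU : U ≠ 0) (ha : a = U + Z) (hs : s ^ 2 = 4 * U * Z) :
    min ‖a + s‖ ‖a - s‖ = ‖U‖ * ‖1 - Complex.sqrt (Z / U)‖ ^ 2 ∧
      max ‖a + s‖ ‖a - s‖ = ‖U‖ * ‖1 + Complex.sqrt (Z / U)‖ ^ 2 := by
  set y := Complex.sqrt (Z / U) with hy
  have hy2 : U * y ^ 2 = Z := by rw [hy, csqrt_sq, mul_div_cancel₀ _ hU]
  have hle : ‖U‖ * ‖1 - y‖ ^ 2 ≤ ‖U‖ * ‖1 + y‖ ^ 2 := by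
    have := norm_one_sub_le_norm_one_add (csqrt_re_nonneg (Z / U))
    rw [← hy] at this
    gcongr
  have e1 : ‖a + 2 * U * y‖ = ‖U‖ * ‖1 + y‖ ^ 2 := by
    rw [← norm_pow, ← norm_mul, ha, ← hy2]; congr 1; ring
  have e2 : ‖a - 2 * U * y‖ = ‖U‖ * ‖1 - y‖ ^ 2 := by
    rw [← norm_pow, ← norm_mul, ha, ← hy2]; congr 1; ring
  have : s = 2 * U * y ∨ s = -(2 * U * y) := by
    rw [← sq_eq_sq_iff_eq_or_eq_neg, hs, ← hy2]; ring
  rcases this with rfl | rfl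
  · rw [e1, e2]
    exact ⟨min_eq_right hle, max_eq_left hle⟩
  · rw [sub_neg_eq_add, ← sub_eq_add_neg, e1, e2]
    exact ⟨min_eq_left hle, max_eq_right hle⟩

/-- The conjugate of `U(x)` is `-Z(x)`. -/
lemma Z_eq_of_not_isSquare {n : ℕ} {t x u₁ u₂ : ℤ} {S : ℂ} (hS : S ^ 2 = t) (ht : ¬ IsSquare t)
    {β₁ β₂ γ₁ γ₂ : ℂ} (hβ : ConjPair S β₁ β₂) (hγ : ConjPair S γ₁ γ₂)
    (hU : U n β₂ γ₂ x = (u₁ + u₂ * S) / 2) : Z n β₁ γ₁ x = (-u₁ + u₂ * S) / 2 := by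
  have h : ConjPair S (U n β₂ γ₂ x) (-Z n β₁ γ₁ x) := by
    have := hγ.symm.neg.mul hS (((ConjPair.intCast x).sub hβ.symm).pow hS n)
    rwa [neg_mul γ₁] at this
  obtain ⟨A, B, h1, h2⟩ := h
  have h3 : ((A - u₁ / 2 : ℚ) : ℂ) + ((B - u₂ / 2 : ℚ) : ℂ) * S = 0 := by
    push_cast; linear_combination hU - h1
  obtain ⟨hA, hB⟩ := coeff_eq_zero_of_not_isSquare hS ht h3
  rw [sub_eq_zero.1 hA, sub_eq_zero.1 hB] at h2
  push_cast at h2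
  linear_combination -h2

/-- In the real case, `w` is bounded away from zero. -/
lemma one_eighth_le_sqrt {n : ℕ} {t u₁ u₂ : ℤ} (hu : u₁ ≠ 0) (ht : t ≠ 0) {S : ℂ}
    (hS : S ^ 2 = t) {U Z : ℂ} (hU : U = (u₁ + u₂ * S) / 2) (hZ : Z = (-u₁ + u₂ * S) / 2)
    (hU0 : U ≠ 0) (hZ0 : Z ≠ 0) {ω : ℝ} (hω0 : 0 < ω) (hω : Z / U = ω)
    (hlt : ‖U‖ * ‖1 - Complex.sqrt (Z / U)‖ ^ 2 < 4 * gTot n u₁ u₂ t) : 1 / 8 ≤ √ω := by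
  have hg := gTot_pos (u₂ := u₂) (t := t) n hu
  set g := gTot n u₁ u₂ t with hgdef
  have hgc : (g : ℂ) ≠ 0 := by exact_mod_cast hg.ne'
  have hUg : IsIntegral ℤ (U / g) := by rw [hU]; exact isIntegral_div_gTot n hu hS
  have hZg : IsIntegral ℤ (Z / g) := by
    have := isIntegral_div_gTot (u₂ := u₂) n hu (S := -S) (by rw [neg_sq, hS])
    have h2 := this.neg
    convert! h2 using 1
    rw [hZ]; ring
  obtain ⟨q, m, hm0, -, hgq⟩ := exists_gTot_eq (u₂ := u₂) n hu ht
  have hg2 : (g : ℂ) ^ 2 = ((q ^ 2 * m : ℚ) : ℂ) := by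
    rw [hgdef, hgq, ← Complex.ofReal_pow, mul_pow, Real.sq_sqrt (by positivity)]
    push_cast; ring
  have hprod : U / g * (Z / g) = (((u₂ ^ 2 * t - u₁ ^ 2) / 4 / (q ^ 2 * m) : ℚ) : ℂ) := by
    rw [div_mul_div_comm, ← sq, hg2, hU, hZ]
    push_cast
    rw [← hS]
    ring
  -- UZ/g² is integral, rational and nonzero, hence at least 1 in modulus. This gives g ≤ ‖U‖√ω, and
  -- then (1 - √ω)² < 4√ω, so √ω > 3 - 2√2 > 1/8.
  obtain ⟨k, hk⟩ := exists_int_of_isIntegral_of_rat (hUg.mul hZg) hprod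
  have hk0 : k ≠ 0 := by
    rintro rfl
    have : U / g * (Z / g) ≠ 0 := mul_ne_zero (div_ne_zero hU0 hgc) (div_ne_zero hZ0 hgc)
    rw [hk] at this; simp at this
  have hnorm : g ^ 2 ≤ ‖U‖ * ‖Z‖ := by
    have h1 : (1 : ℝ) ≤ ‖U / g * (Z / g)‖ := by
      rw [hk, Complex.norm_intCast]; exact_mod_cast Int.one_le_abs hk0
    rw [div_mul_div_comm, norm_div, norm_mul, norm_mul, Complex.norm_real,
      Real.norm_of_nonneg hg.le, one_le_div (by positivity)] at h1
    linarith
  have hZn : ‖Z‖ = ‖U‖ * ω := by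
    rw [div_eq_iff hU0] at hω
    rw [hω, norm_mul, Complex.norm_real, Real.norm_of_nonneg hω0.le, mul_comm]
  have hs0 : 0 ≤ √ω := Real.sqrt_nonneg _
  have hsq : √ω ^ 2 = ω := Real.sq_sqrt hω0.le
  have hUn : 0 < ‖U‖ := norm_pos_iff.2 hU0
  have hgU : g ≤ ‖U‖ * √ω := by
    refine le_of_sq_le_sq ?_ (by positivity)
    rw [mul_pow, hsq]
    rw [hZn] at hnorm
    linarith
  have hy : ‖1 - Complex.sqrt (Z / U)‖ ^ 2 = (1 - √ω) ^ 2 := by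
    have : Complex.sqrt (ω : ℂ) = ((√ω : ℝ) : ℂ) := by
      have := Complex.sqrt_of_nonneg (a := (ω : ℂ)) (by exact_mod_cast hω0.le)
      simpa using this
    rw [hω, this, ← Complex.ofReal_one, ← Complex.ofReal_sub, Complex.norm_real, Real.norm_eq_abs,
      sq_abs]
  rw [hy] at hlt
  have h3 : (1 - √ω) ^ 2 < 4 * √ω := by
    have : ‖U‖ * (1 - √ω) ^ 2 < ‖U‖ * (4 * √ω) := by linarith
    exact lt_of_mul_lt_mul_left this hUn.le
  by_contra! hcon
  nlinarith

end

end ThueFT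

/-- The hypotheses indexed by `IsSquare t` are automatic when `t` is not a perfect square. When it
is one, conjugation means changing the sign of `√t`, and they say that `β₂` is an algebraic integer
too and that `u₁`, `u₂` come from the formal expansion of `U(x)` (so that `-Z(x)` is the
conjugate of `U(x)`). `hA_def` says that `𝒜(x)` is defined. -/
theorem corollary2p4
    (n : ℕ) (t x : ℤ) (hn : 3 ≤ n) (ht : t ≠ 0)
    (a b : ℚ) (hb : b ≠ 0) (β₁ β₂ : ℂ)
    (hβ₁ : β₁ = a + b * Complex.sqrt t) (hβ₂ : β₂ = a - b * Complex.sqrt t)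
    (hβ₁_int : IsIntegral ℤ β₁) (hβ₂_int : IsSquare t → IsIntegral ℤ β₂)
    (v w : ℚ) (γ₁ γ₂ : ℂ)
    (hγ₁ : γ₁ = v + w * Complex.sqrt t) (hγ₂ : γ₂ = v - w * Complex.sqrt t)
    (hγ₁_int : IsIntegral ℤ γ₁)
    (u₁ u₂ : ℤ)
    (hU : ThueFT.U n β₂ γ₂ x = (u₁ + u₂ * Complex.sqrt t) / 2)
    (hZ : IsSquare t → ThueFT.Z n β₁ γ₁ x = (-u₁ + u₂ * Complex.sqrt t) / 2)
    (g : ℝ) (hg : g = ThueFT.gTot n u₁ u₂ t)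
    (d : ℕ)
    (hd : IsGreatest {d : ℕ | 0 < d ∧ IsIntegral ℤ ((u₁ : ℝ) / (d * g))} d)
    (C D : ℝ) (hCD : ThueFT.Admissible d n C D)
    (W A : ℂ) (hW : W = ThueFT.W n β₁ β₂ γ₁ γ₂ x) (hA : A = ThueFT.calA n β₁ β₂ γ₁ γ₂ x)
    (hA_def : ThueFT.calADen n β₁ β₂ γ₁ γ₂ x ≠ 0)
    (s : ℂ) (hs : s = Complex.sqrt ((u₂ : ℂ) ^ 2 * t - (u₁ : ℂ) ^ 2))
    (E Q κ c : ℝ)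
    (hE : E = |g| * ThueFT.calN d n /
      (D * min ‖u₂ * Complex.sqrt t + s‖ ‖u₂ * Complex.sqrt t - s‖))
    (hQ : Q = D * max ‖u₂ * Complex.sqrt t + s‖ ‖u₂ * Complex.sqrt t - s‖ /
      (|g| * ThueFT.calN d n))
    (hκ : κ = Real.log Q / Real.log E)
    (hc : c = 4 * √|2 * (t : ℝ)| * (‖x - β₁‖ + ‖x - β₂‖) * C * Q *
      (max 1 (5 * √|2 * (t : ℝ)| * ‖1 - ThueFT.nthRoot n W‖ * ‖x - β₂‖ * ‖A - β₁‖ * C * E)) ^ κ)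
    (hE_gt : 1 < E)
    (hW_cond : (∃ ω : ℝ, 0 < ω ∧ ω < 1 ∧ W = ω) ∨ (‖W‖ = 1 ∧ W ≠ -1)) :
    ∀ p q : ℤ, q ≠ 0 → 1 / (c * |(q : ℝ)| ^ (κ + 1)) < ‖A - (p : ℂ) / (q : ℂ)‖ := by
  intro p q hq
  set S := Complex.sqrt t with hSdef
  have hS : S ^ 2 = t := ThueFT.csqrt_sq _
  have hS0 : S ≠ 0 := by
    rintro h
    apply ht
    have : (t : ℂ) = 0 := by rw [← hS, h]; norm_num
    exact_mod_cast this
  -- If u₁ were 0, every positive d would qualify and there would be no greatest one.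
  have hu : u₁ ≠ 0 := by
    rintro rfl
    have := hd.2 (show d + 1 ∈ {d : ℕ | 0 < d ∧ IsIntegral ℤ (((0 : ℤ) : ℝ) / (d * g))} from
      ⟨d.succ_pos, by simpa using isIntegral_zero⟩)
    omega
  have hβ : ThueFT.ConjPair S β₁ β₂ := ⟨a, b, hβ₁, hβ₂⟩
  have hγ : ThueFT.ConjPair S γ₁ γ₂ := ⟨v, w, hγ₁, hγ₂⟩
  have hβ₂i : IsIntegral ℤ β₂ := by
    by_cases h : IsSquare t
    · exact hβ₂_int h
    · exact hβ.isIntegral hS h hβ₁_int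
  have hZ' : ThueFT.Z n β₁ γ₁ x = (-u₁ + u₂ * S) / 2 := by
    by_cases h : IsSquare t
    · exact hZ h
    · exact ThueFT.Z_eq_of_not_isSquare hS h hβ hγ hU
  have hWZ : W = ThueFT.Z n β₁ γ₁ x / ThueFT.U n β₂ γ₂ x := hW
  have hW0 : W ≠ 0 := by
    rcases hW_cond with ⟨ω, h0, -, rfl⟩ | ⟨h, -⟩
    · exact_mod_cast h0.ne'
    · rintro rfl; simp at h
  have hx₁ : (x : ℂ) - β₁ ≠ 0 := by
    intro h
    rw [hWZ, ThueFT.Z, h, zero_pow (by omega)] at hW0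
    simp at hW0
  have hx₂ : (x : ℂ) - β₂ ≠ 0 := by
    intro h
    rw [hWZ, ThueFT.U, h, zero_pow (by omega)] at hW0
    simp at hW0
  set U := ThueFT.U n β₂ γ₂ x with hUdef
  set Z := ThueFT.Z n β₁ γ₁ x with hZdef
  have hU0 : U ≠ 0 := by rintro h; rw [hWZ, h] at hW0; simp at hW0
  have hZ0 : Z ≠ 0 := by rintro h; rw [hWZ, h] at hW0; simp at hW0
  have hW1 : W ≠ 1 := by
    intro h
    rw [hWZ, div_eq_one_iff_eq hU0, hU, hZ'] at h
    apply hu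
    have : (u₁ : ℂ) = 0 := by linear_combination -h
    exact_mod_cast this
  have hg0 : 0 < g := by rw [hg]; exact ThueFT.gTot_pos n hu
  have hN0 := ThueFT.calN_pos d n
  obtain ⟨hC0, hD0, -⟩ := id hCD
  have hdg : IsIntegral ℤ ((u₁ : ℂ) / (d * (ThueFT.gTot n u₁ u₂ t : ℝ))) := by
    have h := hd.1.2
    rw [hg] at h
    have h2 := h.map (Complex.ofRealHom.toIntAlgHom)
    simpa using h2
  obtain ⟨hmin, hmax⟩ := ThueFT.min_max_norm_eq (a := u₂ * S) (s := s) hU0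
    (show (u₂ : ℂ) * S = U + Z by rw [hU, hZ']; ring)
    (by rw [hs, ThueFT.csqrt_sq, hU, hZ', ← hS]; ring)
  rw [hmin, ← hWZ, abs_of_pos hg0] at hE
  rw [hmax, ← hWZ, abs_of_pos hg0] at hQ
  set y := Complex.sqrt W with hy
  have hUn : 0 < ‖U‖ := norm_pos_iff.2 hU0
  have hy1 : 0 < ‖1 - y‖ := by
    rw [norm_pos_iff, sub_ne_zero]
    intro h
    apply hW1
    rw [← ThueFT.csqrt_sq W, ← hy, ← h]; norm_num
  have hy2 : 0 < ‖1 + y‖ := hy1.trans_le (ThueFT.norm_one_sub_le_norm_one_add (ThueFT.csqrt_re_nonneg W))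
  have hQ0 : 0 < Q := by rw [hQ]; positivity
  have hWc : (∃ x : ℝ, 0 < x ∧ x < 1 ∧ 1 / 8 ≤ √x ∧ W = x) ∨ ‖W‖ = 1 := by
    rcases hW_cond with ⟨ω, h0, h1, h⟩ | ⟨h, -⟩
    · refine Or.inl ⟨ω, h0, h1, ?_, h⟩
      refine ThueFT.one_eighth_le_sqrt (n := n) hu ht hS hU hZ' hU0 hZ0 h0 (by rw [← hWZ, h]) ?_
      rw [← hWZ, ← hg, ← hy]
      have h2 := hE_gt
      rw [hE, one_lt_div (by positivity)] at h2
      have h3 := hCD.calN_le (by omega)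
      have h4 : D * (‖U‖ * ‖1 - y‖ ^ 2) < D * (4 * g) := by nlinarith
      exact lt_of_mul_lt_mul_left h4 hD0.le
    · exact Or.inr h
  have hest := ThueFT.hyp_estimates hn hW1 hWc
  rw [← hy] at hest
  set ω := ThueFT.nthRoot n W with hω
  -- The Möbius relation solved for ω: it makes R 𝒜 - P proportional to the Padé remainder.
  have hAω : ((x : ℂ) - β₂) * ω * (A - β₁) = (x - β₁) * (A - β₂) := by
    have h1 : A * ThueFT.calADen n β₁ β₂ γ₁ γ₂ x =
        β₁ * (x - β₂) * ω - β₂ * (x - β₁) := by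
      rw [hA, ThueFT.calA, div_mul_cancel₀ _ hA_def, hω, hW]
    rw [ThueFT.calADen, ← hW, ← hω] at h1
    linear_combination h1
  choose τ hτ0 hτn hτ using ThueFT.exists_int_scale (n := n) (by omega) ht hu hS hU hZ' hU0 hZ0 hd.1.1 hdg
  rw [← hWZ] at hτ
  rw [← hg] at hτ
  have hxβ : ThueFT.ConjPair S ((x : ℂ) - β₂) (x - β₁) := (ThueFT.ConjPair.intCast x).sub hβ.symm
  have hxi₁ : IsIntegral ℤ ((x : ℂ) - β₁) := (ThueFT.isIntegral_intCast x).sub hβ₁_int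
  have hxi₂ : IsIntegral ℤ ((x : ℂ) - β₂) := (ThueFT.isIntegral_intCast x).sub hβ₂i
  choose R hR using fun r => hτ r _ _ hxβ hxi₂ hxi₁
  choose P hP using fun r => hτ r _ _ (hβ.mul hS hxβ) (hβ₁_int.mul hxi₂) (hβ₂i.mul hxi₁)
  have hρ0 : ∀ r, (0 : ℝ) < (ThueFT.denom n r : ℝ) / ThueFT.numGcd d n r := fun r => by
    have := (ThueFT.denom_spec n r).1
    have := ThueFT.numGcd_pos (show 2 ≤ n by omega) d r
    positivity
  set K : ℕ → ℂ := fun r => τ r * ((ThueFT.denom n r : ℂ) / ThueFT.numGcd d n r) / (g : ℂ) ^ r * U ^ r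
    with hK
  have hgc : (g : ℂ) ≠ 0 := by exact_mod_cast hg0.ne'
  have hK0 : ∀ r, K r ≠ 0 := fun r => by
    have h1 : (ThueFT.denom n r : ℂ) ≠ 0 := by exact_mod_cast (ThueFT.denom_spec n r).1.ne'
    have h2 : (ThueFT.numGcd d n r : ℂ) ≠ 0 := by
      exact_mod_cast (ThueFT.numGcd_pos (show 2 ≤ n by omega) d r).ne'
    have := hτ0 r
    simp only [hK]
    positivity
  have hKn : ∀ r, ‖K r‖ ≤ √|2 * (t : ℝ)| *
      ((ThueFT.denom n r : ℝ) / ThueFT.numGcd d n r) * (‖U‖ / g) ^ r := fun r => by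
    have e : ‖K r‖ = ‖τ r‖ * ((ThueFT.denom n r : ℝ) / ThueFT.numGcd d n r) * (‖U‖ / g) ^ r := by
      simp only [hK, norm_mul, norm_div, norm_pow, Complex.norm_natCast, Complex.norm_real,
        Real.norm_of_nonneg hg0.le, div_pow]
      ring
    rw [e]
    have := hτn r
    have := (hρ0 r).le
    gcongr
  have hR' : ∀ r, (R r : ℂ) = K r * ((x - β₂) * ThueFT.hypVal (1 / n) r W - (x - β₁) * ThueFT.hypRev (1 / n) r W) :=
    fun r => by rw [← hR r]; simp only [hK]; ring
  have hP' : ∀ r, (P r : ℂ) = K r * (β₁ * (x - β₂) * ThueFT.hypVal (1 / n) r W -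
      β₂ * (x - β₁) * ThueFT.hypRev (1 / n) r W) :=
    fun r => by rw [← hP r]; simp only [hK]; ring
  have htpos : 0 < √|2 * (t : ℝ)| := Real.sqrt_pos.2 (abs_pos.2 (by
    have : (t : ℝ) ≠ 0 := by exact_mod_cast ht
    simpa using this))
  have hxpos : 0 < ‖(x : ℂ) - β₁‖ + ‖(x : ℂ) - β₂‖ :=
    add_pos (norm_pos_iff.2 hx₁) (norm_pos_iff.2 hx₂)
  have hbd := hCD.bounds (show 2 ≤ n by omega)
  have hmeasure := ThueFT.irrationality_measure (θ := A) (P := P) (R := R) (E := E) (Q := Q) (κ := κ)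
    (k₀ := 2 * √|2 * (t : ℝ)| * (‖(x : ℂ) - β₁‖ + ‖(x : ℂ) - β₂‖) * C)
    (l₀ := 5 / 2 * √|2 * (t : ℝ)| * ‖1 - ω‖ * ‖(x : ℂ) - β₂‖ * ‖A - β₁‖ * C)
    (by positivity) hE_gt hQ0 ?_ ?_ ?_ hκ p q hq
  · have e1 : 2 * (5 / 2 * √|2 * (t : ℝ)| * ‖1 - ω‖ * ‖(x : ℂ) - β₂‖ * ‖A - β₁‖ * C) * E =
        5 * √|2 * (t : ℝ)| * ‖1 - ω‖ * ‖(x : ℂ) - β₂‖ * ‖A - β₁‖ * C * E := by ring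
    have e2 : 2 * (2 * √|2 * (t : ℝ)| * (‖(x : ℂ) - β₁‖ + ‖(x : ℂ) - β₂‖) * C) =
        4 * √|2 * (t : ℝ)| * (‖(x : ℂ) - β₁‖ + ‖(x : ℂ) - β₂‖) * C := by ring
    rw [e1, e2] at hmeasure
    rw [hc]
    exact hmeasure
  · intro r
    obtain ⟨-, h2, h3⟩ := hest r
    have e : |(R r : ℝ)| = ‖(R r : ℂ)‖ := by rw [Complex.norm_intCast]
    rw [e, hR', norm_mul]
    have hG := ThueFT.lowerFactor_pos (α := 1 / n) (by
      rw [div_lt_one (by positivity)]; exact_mod_cast (by omega : 1 < n)) r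
    calc ‖K r‖ * ‖((x : ℂ) - β₂) * ThueFT.hypVal (1 / n) r W - (x - β₁) * ThueFT.hypRev (1 / n) r W‖
        ≤ (√|2 * (t : ℝ)| * ((ThueFT.denom n r : ℝ) / ThueFT.numGcd d n r) * (‖U‖ / g) ^ r) *
          ((‖(x : ℂ) - β₁‖ + ‖(x : ℂ) - β₂‖) *
            (2 * ThueFT.lowerFactor (1 / n) r * (‖1 + y‖ ^ 2) ^ r)) := by
          have := hρ0 r
          refine mul_le_mul (hKn r) ?_ (norm_nonneg _) (by positivity)
          refine (norm_sub_le _ _).trans ?_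
          rw [norm_mul, norm_mul, add_mul, add_comm]
          gcongr
      _ = 2 * √|2 * (t : ℝ)| * (‖(x : ℂ) - β₁‖ + ‖(x : ℂ) - β₂‖) *
          (ThueFT.lowerFactor (1 / n) r * ((ThueFT.denom n r : ℝ) / ThueFT.numGcd d n r)) *
            (‖U‖ / g * ‖1 + y‖ ^ 2) ^ r := by rw [mul_pow (‖U‖ / g)]; ring
      _ < 2 * √|2 * (t : ℝ)| * (‖(x : ℂ) - β₁‖ + ‖(x : ℂ) - β₂‖) *
          (C * (D / ThueFT.calN d n) ^ r) * (‖U‖ / g * ‖1 + y‖ ^ 2) ^ r := by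
          have := (hbd r).1
          gcongr
      _ = 2 * √|2 * (t : ℝ)| * (‖(x : ℂ) - β₁‖ + ‖(x : ℂ) - β₂‖) * C *
          (D / ThueFT.calN d n * (‖U‖ / g * ‖1 + y‖ ^ 2)) ^ r := by
          rw [mul_pow (D / ThueFT.calN d n)]; ring
      _ = _ := by
          rw [hQ]; congr 2; field_simp
  · intro r
    obtain ⟨h1, -, -⟩ := hest r
    have e : (R r : ℂ) * A - P r = -(K r * ((x - β₂) * (A - β₁)) *
        (ω * ThueFT.hypRev (1 / n) r W - ThueFT.hypVal (1 / n) r W)) := by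
      rw [hR', hP']
      linear_combination (K r * ThueFT.hypRev (1 / n) r W) * hAω
    rw [e, norm_neg, norm_mul (K r * _), norm_mul (K r), norm_mul ((x : ℂ) - β₂)]
    have hH := ThueFT.upperFactor_pos (α := 1 / n) (by positivity) r
    have hE0 : 0 < E := by linarith
    calc ‖K r‖ * (‖(x : ℂ) - β₂‖ * ‖A - β₁‖) *
          ‖ω * ThueFT.hypRev (1 / n) r W - ThueFT.hypVal (1 / n) r W‖ * E ^ r
        ≤ (√|2 * (t : ℝ)| * ((ThueFT.denom n r : ℝ) / ThueFT.numGcd d n r) * (‖U‖ / g) ^ r) *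
          (‖(x : ℂ) - β₂‖ * ‖A - β₁‖) *
          (5 / 2 * ThueFT.upperFactor (1 / n) r * ‖1 - ω‖ * (‖1 - y‖ ^ 2) ^ r) * E ^ r := by
          have := hKn r
          have := hρ0 r
          gcongr
      _ = 5 / 2 * √|2 * (t : ℝ)| * ‖1 - ω‖ * ‖(x : ℂ) - β₂‖ * ‖A - β₁‖ *
          (ThueFT.upperFactor (1 / n) r * ((ThueFT.denom n r : ℝ) / ThueFT.numGcd d n r)) *
            (‖U‖ / g * ‖1 - y‖ ^ 2 * E) ^ r := by
          rw [mul_pow, mul_pow (‖U‖ / g)]; ring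
      _ ≤ 5 / 2 * √|2 * (t : ℝ)| * ‖1 - ω‖ * ‖(x : ℂ) - β₂‖ * ‖A - β₁‖ *
          (C * (D / ThueFT.calN d n) ^ r) * (‖U‖ / g * ‖1 - y‖ ^ 2 * E) ^ r := by
          have := (hbd r).2.le
          gcongr
      _ = 5 / 2 * √|2 * (t : ℝ)| * ‖1 - ω‖ * ‖(x : ℂ) - β₂‖ * ‖A - β₁‖ * C *
          (D / ThueFT.calN d n * (‖U‖ / g * ‖1 - y‖ ^ 2 * E)) ^ r := by
          rw [mul_pow (D / ThueFT.calN d n)]; ring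
      _ = _ := by
          -- E is exactly the reciprocal of the decay rate, so the bound l₀ does not depend on r.
          have : D / ThueFT.calN d n * (‖U‖ / g * ‖1 - y‖ ^ 2 * E) = 1 := by
            rw [hE]; field_simp
          rw [this, one_pow, mul_one]
  · intro r h
    have hα0 : (0 : ℝ) < 1 / n := by
      have : (0 : ℝ) < n := by exact_mod_cast (by omega : 0 < n)
      positivity
    have hα1 : (1 : ℝ) / n < 1 := by
      rw [div_lt_one (by exact_mod_cast (by omega : 0 < n))]; exact_mod_cast (by omega : 1 < n)
    have hdet := ThueFT.hypVal_mul_hypRev_sub_ne_zero hα0 hα1 r hW1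
    have hβne : β₂ - β₁ ≠ 0 := by
      rw [hβ₁, hβ₂]
      intro h0
      have : (b : ℂ) * S = 0 := by linear_combination (-1 / 2) * h0
      rcases mul_eq_zero.1 this with h1 | h1
      · exact hb (by exact_mod_cast h1)
      · exact hS0 h1
    have hc0 : ((P r * R (r + 1) - P (r + 1) * R r : ℤ) : ℂ) = 0 := by rw [h]; simp
    -- The determinant of (P, R) is that of (X, Y) times the determinant of the Möbius map, whose
    -- factor β₂ - β₁ = -2b√t is nonzero.
    have e : ((P r * R (r + 1) - P (r + 1) * R r : ℤ) : ℂ) =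
        K r * K (r + 1) * (x - β₂) * (x - β₁) * (β₂ - β₁) *
          (ThueFT.hypVal (1 / n) r W * ThueFT.hypRev (1 / n) (r + 1) W -
            ThueFT.hypVal (1 / n) (r + 1) W * ThueFT.hypRev (1 / n) r W) := by
      push_cast
      rw [hP', hP', hR', hR']
      ring
    rw [e] at hc0
    exact mul_ne_zero (mul_ne_zero (mul_ne_zero (mul_ne_zero (mul_ne_zero (hK0 r) (hK0 (r + 1))) hx₂)
      hx₁) hβne) hdet hc0
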